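/- Let $\Bbbk$ be a commutative ring with unit. For a simplicial set $X$ let $C(X)$ denote its normalized chain complex with coefficients in $\Bbbk$, that is, $C_n(X)$ is the free $\Bbbk$-module on $X_n$ modulo the span of the degenerate $n$-simplices. For $x\in X_n$ write $\partial_p^q x=\partial_p\cdots\partial_q x$ (with $\partial_p^{p-1}x=x$), and for a set $\alpha=\{\alpha_1<\dots<\alpha_p\}$ of natural numbers write $s_\alpha x=s_{\alpha_p}\cdots s_{\alpha_1}x$; let $\alpha+m=\{\alpha_1+m,\dots,\alpha_p+m\}$. A $(p,q)$-shuffle $(\alpha,\beta)\vdash(p,q)$ is a partition of $\{0,\dots,p+q-1\}$ into subsets $\alpha$, $\beta$ of sizes $p$, $q$, and $(-1)^{(\alpha,\beta)}$ is the sign of the permutation $(\alpha_1<\dots<\alpha_p,\beta_1<\dots<\beta_q)$. For simplicial sets $X$, $Y$, the Eilenberg–Mac Lane homotopy $H_{X,Y}\colon C(X\times Y)\to C(X\times Y)$ is the map of degree $1$ given by $$H_{X,Y}(x,y)=\sum_{0\le p+q<n}\ \sum_{(\alpha,\beta)\vdash(p+1,q)}(-1)^{m+1+(\alpha,\beta)}\bigl(s_{\beta+m}\,s_{m-1}\,\partial_{n-q+1}^{n}x,\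 s_{\alpha+m}\,\partial_{m}^{n-q-1}y\bigr)$$ for $(x,y)\in X_n\times Y_n$, where $p,q\ge 0$ and $m=n-p-q$. **Proposition.** For all simplicial sets $X$, $Y$, $Z$, the operators $H_{X\times Y,Z}$ and $H_{X,Y\times Z}$ on $C(X\times Y\times Z)$ (where $(X\times Y)\times Z$ and $X\times(Y\times Z)$ are identified in the canonical way) commute in the graded sense: $$H_{X\times Y,Z}\,H_{X,Y\times Z}=-H_{X,Y\times Z}\,H_{X\times Y,Z}.$$ -/

import Mathlib

open CategoryTheory MonoidalCategory Simplicial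

universe u v

namespace EilenbergZilber

/-! ### Iterated degeneracies and faces -/

/-- The iterated codegeneracy of a set `S = {s₁ < ⋯ < sₚ}` of natural numbers, on vertices:
`σ^{s₁} ∘ ⋯ ∘ σ^{sₚ}`, where `σ^s t = t` for `t ≤ s` and `σ^s t = t - 1` for `t > s`
(see `codegen_singleton` and `codegen_insert`). -/
def codegen (S : Finset ℕ) (t : ℕ) : ℕ := t - (S.filter (· < t)).card

/-- The iterated coface `δ^{p+r-1} ∘ ⋯ ∘ δ^{p}` on vertices, where `δ^p t = t` for `t < p` and
`δ^p t = t + 1` for `t ≥ p` (see `coface_zero` and `coface_succ`). -/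
def coface (p r t : ℕ) : ℕ := if t < p then t else t + r

lemma card_filter_lt_le (S : Finset ℕ) (t : ℕ) : (S.filter (· < t)).card ≤ t := by
  calc (S.filter (· < t)).card ≤ (Finset.range t).card :=
        Finset.card_le_card fun a ha => by simpa using (Finset.mem_filter.1 ha).2
    _ = t := Finset.card_range t

lemma filter_lt_succ (S : Finset ℕ) (t : ℕ) :
    (S.filter (· < t + 1)).card = (S.filter (· < t)).card + if t ∈ S then 1 else 0 := by
  split_ifs with h
  · have : S.filter (· < t + 1) = insert t (S.filter (· < t)) := by
      ext a; simp only [Finset.mem_filter, Finset.mem_insert]; grind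
    rw [this, Finset.card_insert_of_notMem (by simp)]
  · congr 1
    ext a; simp only [Finset.mem_filter]; grind

lemma codegen_zero (S : Finset ℕ) : codegen S 0 = 0 := by simp [codegen]

lemma codegen_succ (S : Finset ℕ) (t : ℕ) :
    codegen S (t + 1) = codegen S t + if t ∈ S then 0 else 1 := by
  have h := card_filter_lt_le S t
  simp only [codegen, filter_lt_succ]
  split_ifs <;> omega

lemma codegen_monotone (S : Finset ℕ) : Monotone (codegen S) :=
  monotone_nat_of_le_succ fun t => by rw [codegen_succ]; omega

lemma codegen_singleton (s t : ℕ) : codegen {s} t = if t ≤ s then t else t - 1 := by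
  simp only [codegen, Finset.filter_singleton]
  split_ifs <;> simp <;> omega

lemma codegen_insert (S : Finset ℕ) (a : ℕ) (ha : ∀ s ∈ S, s < a) (t : ℕ) :
    codegen (insert a S) t = codegen S (codegen {a} t) := by
  have hS : a ∉ S := fun h => lt_irrefl a (ha a h)
  have key : ∀ t, a ≤ t → S.filter (· < t) = S := fun t ht =>
    Finset.filter_true_of_mem fun s hs => (ha s hs).trans_le ht
  rw [codegen_singleton]
  by_cases h : t ≤ a
  · rw [if_pos h]
    simp [codegen, Finset.filter_insert, not_lt.2 h]
  · rw [if_neg h]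
    have h' : a < t := not_le.1 h
    simp only [codegen, Finset.filter_insert, if_pos h', key t h'.le, key (t - 1) (by omega),
      Finset.card_insert_of_notMem hS]
    omega

lemma codegen_last (S : Finset ℕ) (k : ℕ) (hS : S ⊆ Finset.range k) :
    codegen S k = k - S.card := by
  rw [codegen, Finset.filter_true_of_mem fun s hs => Finset.mem_range.1 (hS hs)]

lemma coface_zero (p t : ℕ) : coface p 0 t = t := by simp [coface]

lemma coface_succ (p r t : ℕ) : coface p (r + 1) t = coface (p + r) 1 (coface p r t) := by
  simp only [coface]; split_ifs <;> omega

lemma coface_monotone (p r : ℕ) : Monotone (coface p r) := fun a b h => by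
  simp only [coface]; split_ifs <;> omega

/-- `codegen S` as a morphism `⦋k⦌ ⟶ ⦋n⦌`, for `S ⊆ {0, …, k - 1}` and `k = n + |S|`. -/
def codegenHom (S : Finset ℕ) {n k : ℕ} (hS : S ⊆ Finset.range k) (h : n + S.card = k) :
    ⦋k⦌ ⟶ ⦋n⦌ :=
  SimplexCategory.mkHom
    { toFun := fun t => ⟨codegen S t, by
        have h1 := codegen_monotone S (Nat.lt_succ_iff.1 t.2)
        rw [codegen_last S k hS] at h1
        omega⟩
      monotone' := fun _ _ hst => codegen_monotone S hst }

/-- `coface p r` as a morphism `⦋k⦌ ⟶ ⦋n⦌`, for `n = k + r`. -/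
def cofaceHom (p r : ℕ) {n k : ℕ} (h : k + r = n) : ⦋k⦌ ⟶ ⦋n⦌ :=
  SimplexCategory.mkHom
    { toFun := fun t => ⟨coface p r t, by
        have := t.2
        simp only [coface]; split_ifs <;> omega⟩
      monotone' := fun _ _ hst => coface_monotone p r hst }

/-- The iterated degeneracy `s_S x = s_{sₚ} ⋯ s_{s₁} x` for `S = {s₁ < ⋯ < sₚ}`. -/
def degen (X : SSet.{u}) (S : Finset ℕ) {n k : ℕ} (hS : S ⊆ Finset.range k)
    (h : n + S.card = k) (x : X _⦋n⦌) : X _⦋k⦌ :=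
  X.map (codegenHom S hS h).op x

/-- The iterated face `∂_p ∂_{p+1} ⋯ ∂_{p+r-1} x` (which is `x` for `r = 0`). -/
def face (X : SSet.{u}) (p r : ℕ) {n k : ℕ} (h : k + r = n) (x : X _⦋n⦌) : X _⦋k⦌ :=
  X.map (cofaceHom p r h).op x

/-! ### Shuffles -/

/-- A `(p, q)`-shuffle `(α, β)`: a subset `α` of `{0, …, p + q - 1}` with `p` elements,
together with its complement `β`. -/
def Shuffle (p q : ℕ) : Type := {α : Finset (Fin (p + q)) // α.card = p}

instance (p q : ℕ) : Fintype (Shuffle p q) :=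
  inferInstanceAs (Fintype {α : Finset (Fin (p + q)) // α.card = p})

namespace Shuffle

variable {p q : ℕ} (s : Shuffle p q)

/-- The first block `α`. -/
def fst : Finset (Fin (p + q)) := s.1

/-- The second block `β`. -/
def snd : Finset (Fin (p + q)) := s.1ᶜ

lemma card_fst : s.fst.card = p := s.2

lemma card_snd : s.snd.card = q := by
  rw [snd, Finset.card_compl, s.2, Fintype.card_fin, Nat.add_sub_cancel_left]

/-- The permutation of `{0, …, p + q - 1}` whose list of values is
`(α₁ < ⋯ < αₚ, β₁ < ⋯ < β_q)`. -/
def perm : Equiv.Perm (Fin (p + q)) :=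
  finSumFinEquiv.symm.trans (finSumEquivOfFinset s.card_fst s.card_snd)

/-- The signature `(-1)^{(α, β)}`. -/
def sign : ℤ := (Equiv.Perm.sign s.perm : ℤ)

end Shuffle

/-- The set `A + m = {a + m | a ∈ A}` of natural numbers. -/
def shift {k : ℕ} (A : Finset (Fin k)) (m : ℕ) : Finset ℕ :=
  A.map ⟨fun a => a.val + m, fun _ _ h => Fin.ext (Nat.add_right_cancel h)⟩

lemma card_shift {k : ℕ} (A : Finset (Fin k)) (m : ℕ) : (shift A m).card = A.card :=
  Finset.card_map _

lemma mem_shift {k : ℕ} {A : Finset (Fin k)} {m t : ℕ} :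
    t ∈ shift A m ↔ ∃ a ∈ A, a.val + m = t := by
  simp only [shift, Finset.mem_map]; rfl

lemma shift_subset {k l : ℕ} (A : Finset (Fin k)) (m : ℕ) (h : k + m ≤ l) :
    shift A m ⊆ Finset.range l := fun t ht => by
  obtain ⟨a, -, rfl⟩ := mem_shift.1 ht
  have := a.2
  exact Finset.mem_range.2 (by omega)

/-! ### Normalized chains -/

/-- The degenerate `n`-chains of `X`: the span of the degenerate `n`-simplices in the free
module on all `n`-simplices. -/
noncomputable def degenerateChains (R : Type v) [CommRing R] (X : SSet.{u}) (n : ℕ) :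
    Submodule R (X _⦋n⦌ →₀ R) :=
  Submodule.span R ((fun x => Finsupp.single x 1) '' X.degenerate n)

/-- The module `C_n(X)` of normalized `n`-chains of `X` with coefficients in `R`. -/
abbrev NormalizedChains (R : Type v) [CommRing R] (X : SSet.{u}) (n : ℕ) : Type (max u v) :=
  (X _⦋n⦌ →₀ R) ⧸ degenerateChains R X n

/-- The linear map `C_n(X) → C_n(Y)` induced by a simplicial map. -/
noncomputable def chainMap (R : Type v) [CommRing R] {X Y : SSet.{u}} (f : X ⟶ Y) (n : ℕ) :
    NormalizedChains R X n →ₗ[R] NormalizedChains R Y n :=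
  (degenerateChains R X n).mapQ (degenerateChains R Y n)
    (Finsupp.lmapDomain R R fun x : X _⦋n⦌ => f.app _ x) (by
      rw [degenerateChains, Submodule.span_le]
      rintro _ ⟨x, ⟨m, hm, g, w, rfl⟩, rfl⟩
      simp only [SetLike.mem_coe, Submodule.mem_comap, Finsupp.lmapDomain_apply,
        Finsupp.mapDomain_single]
      exact Submodule.subset_span
        ⟨_, ⟨m, hm, g, f.app _ w, (NatTrans.naturality_apply f g.op w).symm⟩, rfl⟩)

/-! ### The Eilenberg–Mac Lane homotopy -/

/-- The index set of the sum defining the homotopy in degree `n`: pairs `(p, q)` with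
`0 ≤ p + q < n`, together with a `(p + 1, q)`-shuffle. -/
abbrev HIndex (n : ℕ) : Type :=
  Σ pq : {pq : Fin n × Fin n // pq.1.val + pq.2.val < n}, Shuffle (pq.1.1.val + 1) pq.1.2.val

namespace HIndex

variable {n : ℕ} (i : HIndex n)

/-- The index `p`. -/
def p : ℕ := i.1.1.1.val

/-- The index `q`. -/
def q : ℕ := i.1.1.2.val

lemma lt : i.p + i.q < n := i.1.2

/-- The `(p + 1, q)`-shuffle `(α, β)`. -/
def shuffle : Shuffle (i.p + 1) i.q := i.2

/-- The number `m = n - p - q`, which is positive. -/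
def m : ℕ := n - i.p - i.q

lemma m_add : i.m + i.p + i.q = n := by have := i.lt; unfold m; omega

lemma m_pos : 0 < i.m := by have := i.lt; unfold m; omega

/-- The sign `(-1)^{m + 1 + (α, β)}`. -/
def sign : ℤ := (-1) ^ (i.m + 1) * i.shuffle.sign

lemma alpha_subset : shift i.shuffle.fst i.m ⊆ Finset.range (n + 1) :=
  shift_subset _ _ (by have := i.m_add; omega)

lemma beta_subset : shift i.shuffle.snd i.m ⊆ Finset.range (n + 1) :=
  shift_subset _ _ (by have := i.m_add; omega)

/-- The first component `s_{β+m} s_{m-1} ∂_{n-q+1} ⋯ ∂_n x`. -/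
def left (X : SSet.{u}) (x : X _⦋n⦌) : X _⦋n + 1⦌ :=
  degen X (shift i.shuffle.snd i.m) (n := n - i.q + 1) i.beta_subset
    (by rw [card_shift, Shuffle.card_snd]; have := i.m_add; omega)
    (degen X {i.m - 1} (n := n - i.q)
      (by have := i.m_add; have := i.m_pos; simp; omega) (by simp)
      (face X (n - i.q + 1) i.q (by have := i.m_add; omega) x))

/-- The second component `s_{α+m} ∂_m ⋯ ∂_{n-q-1} y`; note that `n - q = m + p`, so that
`p` face operators occur. -/
def right (Y : SSet.{u}) (y : Y _⦋n⦌) : Y _⦋n + 1⦌ :=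
  degen Y (shift i.shuffle.fst i.m) (n := n - i.p) i.alpha_subset
    (by rw [card_shift, Shuffle.card_fst]; have := i.m_add; omega)
    (face Y i.m i.p (by have := i.m_add; omega) y)

/-- The simplex of `X × Y` in the summand of `H(x, y)` with index `i`. -/
def term (X Y : SSet.{u}) (z : (X ⊗ Y) _⦋n⦌) : (X ⊗ Y) _⦋n + 1⦌ :=
  (i.left X z.1, i.right Y z.2)

/-- The operator of `left`, on vertices. -/
def leftHom : ⦋n + 1⦌ ⟶ ⦋n⦌ :=
  codegenHom (shift i.shuffle.snd i.m) (n := n - i.q + 1) i.beta_subset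
      (by rw [card_shift, Shuffle.card_snd]; have := i.m_add; omega) ≫
    codegenHom {i.m - 1} (n := n - i.q)
      (by have := i.m_add; have := i.m_pos; simp; omega) (by simp) ≫
    cofaceHom (n - i.q + 1) i.q (by have := i.m_add; omega)

/-- The operator of `right`, on vertices. -/
def rightHom : ⦋n + 1⦌ ⟶ ⦋n⦌ :=
  codegenHom (shift i.shuffle.fst i.m) (n := n - i.p) i.alpha_subset
      (by rw [card_shift, Shuffle.card_fst]; have := i.m_add; omega) ≫
    cofaceHom i.m i.p (by have := i.m_add; omega)

lemma left_eq (X : SSet.{u}) (x : X _⦋n⦌) : i.left X x = X.map i.leftHom.op x := by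
  simp [left, leftHom, degen, face]

lemma right_eq (Y : SSet.{u}) (y : Y _⦋n⦌) : i.right Y y = Y.map i.rightHom.op y := by
  simp [right, rightHom, degen, face]

/-- The values of `leftHom`. -/
def lv (t : ℕ) : ℕ :=
  coface (n - i.q + 1) i.q (codegen {i.m - 1} (codegen (shift i.shuffle.snd i.m) t))

/-- The values of `rightHom`. -/
def rv (t : ℕ) : ℕ := coface i.m i.p (codegen (shift i.shuffle.fst i.m) t)

lemma leftHom_val (t : Fin (n + 2)) :
    (i.leftHom.toOrderHom t).val = i.lv t := rfl

lemma rightHom_val (t : Fin (n + 2)) :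
    (i.rightHom.toOrderHom t).val = i.rv t := rfl

lemma codegen_shift_of_le {k : ℕ} (A : Finset (Fin k)) (m t : ℕ) (h : t ≤ m) :
    codegen (shift A m) t = t := by
  rw [codegen, Finset.filter_false_of_mem, Finset.card_empty, Nat.sub_zero]
  intro s hs
  obtain ⟨a, -, rfl⟩ := mem_shift.1 hs
  omega

lemma mem_or (t : ℕ) (h : i.m ≤ t) (h' : t ≤ n) :
    (t ∈ shift i.shuffle.fst i.m ∧ t ∉ shift i.shuffle.snd i.m) ∨
      (t ∉ shift i.shuffle.fst i.m ∧ t ∈ shift i.shuffle.snd i.m) := by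
  have hm := i.m_add
  have hlt : t - i.m < i.p + 1 + i.q := by omega
  have key : ∀ A : Finset (Fin (i.p + 1 + i.q)), t ∈ shift A i.m ↔ ⟨t - i.m, hlt⟩ ∈ A := by
    intro A
    rw [mem_shift]
    constructor
    · rintro ⟨a, ha, rfl⟩
      convert ha
      simp
    · intro ha
      exact ⟨_, ha, by simp; omega⟩
  rw [key, key]
  simp only [Shuffle.snd, Shuffle.fst, Finset.mem_compl]
  tauto

lemma exists_step (φ : ℕ → ℕ) (a b j : ℕ) (ha : φ a ≤ j) (hb : j < φ b) (hab : a ≤ b) :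
    ∃ t, a ≤ t ∧ t < b ∧ φ t ≤ j ∧ j < φ (t + 1) := by
  induction b, hab using Nat.le_induction with
  | base => omega
  | succ b hab ih =>
    by_cases h : j < φ b
    · obtain ⟨t, h1, h2, h3⟩ := ih h
      exact ⟨t, h1, by omega, h3⟩
    · exact ⟨b, hab, by omega, by omega, hb⟩

/-- The combinatorial reason why `H` maps degenerate simplices to degenerate simplices. -/
lemma exists_collapse (j : ℕ) (hj : j < n) :
    ∃ t, t ≤ n ∧ (i.lv t = i.lv (t + 1) ∨ i.lv t = j ∧ i.lv (t + 1) = j + 1) ∧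
      (i.rv t = i.rv (t + 1) ∨ i.rv t = j ∧ i.rv (t + 1) = j + 1) := by
  have hm := i.m_add
  have hp := i.m_pos
  have hβ := codegen_shift_of_le i.shuffle.snd i.m
  have hα := codegen_shift_of_le i.shuffle.fst i.m
  have sβ := codegen_succ (shift i.shuffle.snd i.m)
  have sα := codegen_succ (shift i.shuffle.fst i.m)
  have mo := i.mem_or
  have lβ := codegen_last _ _ i.beta_subset
  have lα := codegen_last _ _ i.alpha_subset
  have mβ := codegen_monotone (shift i.shuffle.snd i.m)
  have mα := codegen_monotone (shift i.shuffle.fst i.m)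
  rw [card_shift, Shuffle.card_snd] at lβ
  rw [card_shift, Shuffle.card_fst] at lα
  simp only [lv, rv, codegen_singleton, coface]
  by_cases h1 : j + 1 < i.m
  · refine ⟨j, by omega, ?_, ?_⟩
    · rw [hβ j (by omega), hβ (j + 1) (by omega)]; grind
    · rw [hα j (by omega), hα (j + 1) (by omega)]; grind
  by_cases h2 : j < n - i.q
  · obtain ⟨t, t1, t2, t3, t4⟩ := exists_step (codegen (shift i.shuffle.snd i.m)) i.m (n + 1)
      (j + 1) (by rw [hβ _ le_rfl]; omega) (by omega) (by omega)
    have hs := sβ t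
    have hs' := sα t
    have hmo := mo t t1 (by omega)
    refine ⟨t, by omega, ?_, ?_⟩
    · grind
    · grind
  · obtain ⟨t, t1, t2, t3, t4⟩ := exists_step (codegen (shift i.shuffle.fst i.m)) i.m (n + 1)
      (j - i.p) (by rw [hα _ le_rfl]; omega) (by omega) (by omega)
    have hs := sβ t
    have hs' := sα t
    have hmo := mo t t1 (by omega)
    have hmm := mα t1
    rw [hα _ le_rfl] at hmm
    refine ⟨t, by omega, ?_, ?_⟩
    · grind
    · grind

lemma term_mem_degenerate (X Y : SSet.{u}) (z : (X ⊗ Y) _⦋n⦌)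
    (hz : z ∈ (X ⊗ Y).degenerate n) : i.term X Y z ∈ (X ⊗ Y).degenerate (n + 1) := by
  obtain _ | k := n
  · rw [SSet.degenerate_zero] at hz
    exact hz.elim
  rw [SSet.degenerate_eq_iUnion_range_σ] at hz
  obtain ⟨j, w, rfl⟩ := Set.mem_iUnion.1 hz
  obtain ⟨t, ht, h1, h2⟩ := i.exists_collapse j j.2
  let s : Fin (k + 2) := ⟨t, Nat.lt_succ_iff.2 ht⟩
  have key : ∀ f : ⦋k + 1 + 1⦌ ⟶ ⦋k + 1⦌,
      ((f.toOrderHom s.castSucc).val =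
          (f.toOrderHom s.succ).val ∨
        (f.toOrderHom s.castSucc).val = j ∧
          (f.toOrderHom s.succ).val = j + 1) →
      ∃ θ : ⦋k + 1⦌ ⟶ ⦋k⦌,
        f ≫ SimplexCategory.σ j = SimplexCategory.σ s ≫ θ := by
    intro f hf
    refine SimplexCategory.eq_σ_comp_of_not_injective' _ _ ?_
    change (SimplexCategory.σ j).toOrderHom (f.toOrderHom _) =
      (SimplexCategory.σ j).toOrderHom (f.toOrderHom _)
    rcases hf with hf | ⟨hf, hf'⟩
    · rw [Fin.ext hf]
    · have e1 : f.toOrderHom s.castSucc = j.castSucc := Fin.ext hf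
      have e2 : f.toOrderHom s.succ = j.succ := Fin.ext hf'
      rw [e1, e2]
      change j.predAbove j.castSucc = j.predAbove j.succ
      simp
  obtain ⟨θ, hθ⟩ := key i.leftHom h1
  obtain ⟨η, hη⟩ := key i.rightHom h2
  have eq1 : i.left X (X.map (SimplexCategory.σ j).op w.1) =
      X.map (SimplexCategory.σ s).op (X.map θ.op w.1) := by
    rw [left_eq, ← Functor.map_comp_apply, ← Functor.map_comp_apply, ← op_comp, ← op_comp, hθ]
  have eq2 : i.right Y (Y.map (SimplexCategory.σ j).op w.2) =
      Y.map (SimplexCategory.σ s).op (Y.map η.op w.2) := by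
    rw [right_eq, ← Functor.map_comp_apply, ← Functor.map_comp_apply, ← op_comp, ← op_comp, hη]
  exact ⟨k + 1, by omega, SimplexCategory.σ s,
    (X.map θ.op w.1, Y.map η.op w.2), (Prod.ext eq1 eq2).symm⟩

end HIndex

/-- The homotopy before normalization: the linear map with
`(x, y) ↦ ∑_{0 ≤ p+q < n} ∑_{(α,β) ⊢ (p+1,q)} (-1)^{m+1+(α,β)}
  (s_{β+m} s_{m-1} ∂_{n-q+1}^n x, s_{α+m} ∂_m^{n-q-1} y)`, where `m = n - p - q`. -/
noncomputable def homotopyPre (R : Type v) [CommRing R] (X Y : SSet.{u}) (n : ℕ) :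
    ((X ⊗ Y) _⦋n⦌ →₀ R) →ₗ[R] ((X ⊗ Y) _⦋n + 1⦌ →₀ R) :=
  Finsupp.lift _ R _ fun z => ∑ i : HIndex n, Finsupp.single (i.term X Y z) (i.sign : R)

lemma homotopyPre_degenerate (R : Type v) [CommRing R] (X Y : SSet.{u}) (n : ℕ) :
    degenerateChains R (X ⊗ Y) n ≤
      (degenerateChains R (X ⊗ Y) (n + 1)).comap (homotopyPre R X Y n) := by
  rw [degenerateChains, Submodule.span_le]
  rintro _ ⟨z, hz, rfl⟩
  simp only [SetLike.mem_coe, Submodule.mem_comap, homotopyPre, Finsupp.lift_apply, zero_smul,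
    Finsupp.sum_single_index, one_smul]
  refine Submodule.sum_mem _ fun i _ => ?_
  rw [← mul_one (i.sign : R), ← smul_eq_mul, ← Finsupp.smul_single]
  exact Submodule.smul_mem _ _
    (Submodule.subset_span ⟨_, i.term_mem_degenerate X Y z hz, rfl⟩)

/-- The Eilenberg–Mac Lane homotopy `H_{X,Y} : C_n(X × Y) → C_{n+1}(X × Y)` on normalized
chains. -/
noncomputable def homotopy (R : Type v) [CommRing R] (X Y : SSet.{u}) (n : ℕ) :
    NormalizedChains R (X ⊗ Y) n →ₗ[R] NormalizedChains R (X ⊗ Y) (n + 1) :=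
  (degenerateChains R (X ⊗ Y) n).mapQ (degenerateChains R (X ⊗ Y) (n + 1))
    (homotopyPre R X Y n) (homotopyPre_degenerate R X Y n)

/-- The homotopy `H_{X×Y,Z}` on `C(X × Y × Z)`, where `X × Y × Z` means `(X × Y) × Z`. -/
noncomputable def homotopyXYZ₁ (R : Type v) [CommRing R] (X Y Z : SSet.{u}) (n : ℕ) :
    NormalizedChains R ((X ⊗ Y) ⊗ Z) n →ₗ[R] NormalizedChains R ((X ⊗ Y) ⊗ Z) (n + 1) :=
  homotopy R (X ⊗ Y) Z n

/-- The homotopy `H_{X,Y×Z}` on `C(X × Y × Z)`, where `X × Y × Z` means `(X × Y) × Z` and is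
identified with `X × (Y × Z)` by means of the canonical isomorphism. -/
noncomputable def homotopyXYZ₂ (R : Type v) [CommRing R] (X Y Z : SSet.{u}) (n : ℕ) :
    NormalizedChains R ((X ⊗ Y) ⊗ Z) n →ₗ[R] NormalizedChains R ((X ⊗ Y) ⊗ Z) (n + 1) :=
  chainMap R (α_ X Y Z).inv (n + 1) ∘ₗ homotopy R X (Y ⊗ Z) n ∘ₗ chainMap R (α_ X Y Z).hom n

end EilenbergZilber

/-! A summand of `H` pulls `(x, y)` back along a pair of monotone maps `(f, g)`, that is, along a
lattice path that follows the diagonal to `(a, a)`, jumps to `(a, b)` and then runs in unit steps to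
`(b, n)`, where `a = m - 1` and `b = n - q`. Such paths are exactly the summands (`HIndex.isPath`,
`IsPath.exists_index`, `HIndex.ext_of_eq`), and the exponent of the sign is `a` plus the area
between the path and the horizontal line at height `b` (`HIndex.sign_eq`).

The summands of the two composites are therefore triples `(f ∘ u, g ∘ u, g ∘ v)` and `(k ∘ w, k ∘ z,
l ∘ z)` built from two paths each. A triple that repeats a value at consecutive places gives a
degenerate simplex and drops out. Otherwise the pair of paths is rigid. In the first kind, `f` is
constant and `g s = s - 1` from the corner height `b'` of `(u, v)` on; in the second, `k` has slope
one on the interval `[c', d']` over which `z` jumps.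

By this rigidity a triple determines its two paths (`IsLeftPair.unique`, `IsRightPair.unique`), and
every surviving triple of one kind can be refactored as one of the other kind
(`IsLeftPair.exists_matched`, `IsRightPair.exists_left`). Hence the surviving summands of the two
composites are in bijection. Comparing the accumulated areas time by time shows that matched
exponents differ by an odd number (`Matched.odd_exponent`), so the two sums are negatives of each
other. -/

namespace EilenbergZilber

/-! ### The signature of a shuffle -/

namespace Shuffle

variable {p q : ℕ} (s : Shuffle p q)

lemma perm_castAdd (i : Fin p) :
    s.perm (Fin.castAdd q i) = s.fst.orderEmbOfFin s.card_fst i := by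
  simp [perm, fst]

lemma perm_natAdd (j : Fin q) :
    s.perm (Fin.natAdd p j) = s.snd.orderEmbOfFin s.card_snd j := by
  simp [perm, fst, snd]

/-- The signature of a shuffle counts the pairs `(x, y) ∈ α × β` with `y < x`. -/
lemma sign_eq : s.sign = (-1) ^ ∑ x ∈ s.fst, (s.snd.filter (· < x)).card := by
  have h1 : Equiv.Perm.sign s.perm =
      ∏ i, ∏ j, if i < j ∧ s.perm j < s.perm i then (-1 : ℤˣ) else 1 := by
    rw [Equiv.Perm.sign_eq_prod_prod_Ioi]
    refine Finset.prod_congr rfl fun i _ => ?_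
    rw [← Finset.filter_lt_eq_Ioi, Finset.prod_filter]
    refine Finset.prod_congr rfl fun j _ => ?_
    have : i < j → s.perm i ≠ s.perm j := fun h h' => h.ne (s.perm.injective h')
    grind
  -- The permutation is increasing on each block, so only inversions between the two blocks survive.
  have h2 : Equiv.Perm.sign s.perm = ∏ i : Fin p, ∏ j : Fin q,
      if s.snd.orderEmbOfFin s.card_snd j < s.fst.orderEmbOfFin s.card_fst i then
        (-1 : ℤˣ) else 1 := by
    rw [h1, Fin.prod_univ_add]
    have e : ∀ i : Fin q, ∀ j : Fin p, ¬ Fin.natAdd p i < Fin.castAdd q j := fun i j => by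
      rw [Fin.lt_def]; simp; omega
    have e' : ∀ i : Fin p, ∀ j : Fin q, Fin.castAdd q i < Fin.natAdd p j := fun i j => by
      rw [Fin.lt_def]; simp; omega
    have e'' : ∀ i j : Fin p, Fin.castAdd q i < Fin.castAdd q j ↔ i < j := fun _ _ => Iff.rfl
    have c : ∀ i j : Fin p, ¬ (i < j ∧ j < i) := fun i j h => lt_asymm h.1 h.2
    have c' : ∀ i j : Fin q, ¬ (i < j ∧ j < i) := fun i j h => lt_asymm h.1 h.2
    simp [Fin.prod_univ_add, perm_castAdd, perm_natAdd, e, e', e'', c, c']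
  have h3 : Equiv.Perm.sign s.perm = ∏ x ∈ s.fst, ∏ y ∈ s.snd,
      if y < x then (-1 : ℤˣ) else 1 := by
    have key : ∀ {k l : ℕ} (S : Finset (Fin k)) (hS : S.card = l) (F : Fin k → ℤˣ),
        ∏ x ∈ S, F x = ∏ i, F (S.orderEmbOfFin hS i) := by
      intro k l S hS F
      conv_lhs => rw [← Finset.image_orderEmbOfFin_univ S hS]
      exact Finset.prod_image (by intro; simp)
    rw [h2, key _ s.card_fst]
    exact Finset.prod_congr rfl fun i _ => (key _ s.card_snd fun y =>
      if y < s.fst.orderEmbOfFin s.card_fst i then (-1 : ℤˣ) else 1).symm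
  rw [sign, h3]
  simp [Finset.prod_ite, Finset.prod_pow_eq_pow_sum]

end Shuffle

/-! ### Lattice paths -/

lemma monotone_upto {N : ℕ} {f : ℕ → ℕ} (h : ∀ t ≤ N, f t ≤ f (t + 1)) {s t : ℕ}
    (hst : s ≤ t) (ht : t ≤ N + 1) : f s ≤ f t := by
  induction t, hst using Nat.le_induction with
  | base => rfl
  | succ t hst ih => exact (ih (by omega)).trans (h t (by omega))

/-- The pair `(f, g)` describes the vertices of a summand of the Eilenberg–Mac Lane homotopy in
degree `n`: the path `(0, 0), …, (a, a), (a, b), …, (b, n)` with unit steps after `(a, b)`. -/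
structure IsPath (n a b : ℕ) (f g : ℕ → ℕ) : Prop where
  lt : a < b
  le : b ≤ n
  left_diag : ∀ t ≤ a, f t = t
  right_diag : ∀ t ≤ a, g t = t
  left_succ : f (a + 1) = a
  left_last : f (n + 1) = b
  -- Together with monotonicity this encodes the unit steps: the sum grows by one, so exactly one
  -- coordinate moves.
  add : ∀ t, a < t → t ≤ n + 1 → f t + g t + 1 = t + b
  left_mono : ∀ t ≤ n, f t ≤ f (t + 1)
  right_mono : ∀ t ≤ n, g t ≤ g (t + 1)

namespace IsPath

/-- The first component of a path determines the path. -/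
lemma of_left {n a b : ℕ} {f : ℕ → ℕ} (lt : a < b) (le : b ≤ n) (diag : ∀ t ≤ a, f t = t)
    (succ : f (a + 1) = a) (last : f (n + 1) = b)
    (step : ∀ t, a < t → t ≤ n → f t ≤ f (t + 1) ∧ f (t + 1) ≤ f t + 1) :
    IsPath n a b f (fun t => if t ≤ a then t else t + b - 1 - f t) := by
  -- This keeps the truncated subtraction in the second component honest.
  have bound : ∀ t, a + 1 ≤ t → t ≤ n + 1 → f t + 1 ≤ t := by
    intro t ht
    induction t, ht using Nat.le_induction with
    | base => omega
    | succ t ht ih =>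
      intro h
      have := ih (by omega)
      have := step t ht (by omega)
      omega
  refine ⟨lt, le, diag, fun t ht => if_pos ht, succ, last, fun t h1 h2 => ?_,
    fun t ht => ?_, fun t ht => ?_⟩
  · have := bound t h1 h2
    grind
  · rcases lt_trichotomy t a with h | rfl | h
    · rw [diag t h.le, diag (t + 1) h]; omega
    · rw [diag t le_rfl, succ]
    · exact (step t h ht).1
  · rcases lt_trichotomy t a with h | rfl | h
    · grind
    · grind
    · have := step t h ht
      grind

variable {n a b : ℕ} {f g : ℕ → ℕ} (h : IsPath n a b f g)
include h

lemma right_succ : g (a + 1) = b := by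
  have := h.lt; have := h.le
  have := h.add (a + 1) (by omega) (by omega)
  have := h.left_succ
  omega

lemma right_last : g (n + 1) = n := by
  have := h.lt; have := h.le
  have := h.add (n + 1) (by omega) (by omega)
  have := h.left_last
  omega

lemma bounds (t : ℕ) (ht : a < t) (ht' : t ≤ n + 1) :
    a ≤ f t ∧ f t ≤ b ∧ b ≤ g t ∧ g t ≤ n := by
  have h1 := monotone_upto h.left_mono (show a + 1 ≤ t by omega) ht'
  have h2 := monotone_upto h.left_mono ht' le_rfl
  have h3 := monotone_upto h.right_mono (show a + 1 ≤ t by omega) ht'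
  have h4 := monotone_upto h.right_mono ht' le_rfl
  rw [h.left_succ] at h1
  rw [h.left_last] at h2
  rw [h.right_succ] at h3
  rw [h.right_last] at h4
  exact ⟨h1, h2, h3, h4⟩

lemma step (t : ℕ) (ht : a < t) (ht' : t ≤ n) :
    (f (t + 1) = f t + 1 ∧ g (t + 1) = g t) ∨ (f (t + 1) = f t ∧ g (t + 1) = g t + 1) := by
  have := h.add t ht (by omega)
  have := h.add (t + 1) (by omega) (by omega)
  have := h.left_mono t ht'
  have := h.right_mono t ht'
  omega

lemma left_slow (t : ℕ) (ht : t ≤ n) : f (t + 1) = f t ∨ f (t + 1) = f t + 1 := by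
  rcases lt_trichotomy t a with h' | rfl | h'
  · rw [h.left_diag t h'.le, h.left_diag (t + 1) h']; omega
  · rw [h.left_diag t le_rfl, h.left_succ]; omega
  · rcases h.step t h' ht with h | h <;> omega

lemma left_le (t : ℕ) (ht : t ≤ n + 1) : f t ≤ b := by
  have := monotone_upto h.left_mono ht le_rfl
  rwa [h.left_last] at this

lemma right_le (t : ℕ) (ht : t ≤ n + 1) : g t ≤ n := by
  have := monotone_upto h.right_mono ht le_rfl
  rwa [h.right_last] at this

/-- The path determines its first corner. -/
lemma eq_of_eq {a' b' : ℕ} {f' g' : ℕ → ℕ} (h' : IsPath n a' b' f' g')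
    (e : ∀ t ≤ n + 1, f t = f' t) : a = a' ∧ b = b' := by
  have := h.lt; have := h.le; have := h'.lt; have := h'.le
  have h1 := h.left_last
  rw [e _ le_rfl, h'.left_last] at h1
  refine ⟨?_, h1.symm⟩
  rcases lt_trichotomy a a' with h2 | h2 | h2
  · have := h.left_succ
    rw [e _ (by omega), h'.left_diag _ (by omega)] at this
    omega
  · exact h2
  · have := h'.left_succ
    rw [← e _ (by omega), h.left_diag _ (by omega)] at this
    omega

end IsPath

/-- The exponent of the sign of a path. -/
def pathExponent (n a b : ℕ) (f g : ℕ → ℕ) : ℤ :=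
  a + ∑ t ∈ Finset.range (n + 1), if a < t then ((f (t + 1) : ℤ) - f t) * (g t - b) else 0

/-! ### Summands of the homotopy as lattice paths -/

namespace HIndex

variable {n : ℕ} (i : HIndex n)

/-- The first coordinate of the corner of the path of `i`. -/
def a : ℕ := i.m - 1

/-- The last coordinate of the corner of the path of `i`. -/
def b : ℕ := n - i.q

/-- From `m` on, each time lies in exactly one of `α + m` and `β + m`, and degenerating along `β`
leaves precisely the `α`-times as steps of the first coordinate. -/
lemma lv_succ (t : ℕ) (h : i.m ≤ t) (h' : t ≤ n) :
    i.lv (t + 1) = i.lv t + if t ∈ shift i.shuffle.fst i.m then 1 else 0 := by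
  have hm := i.m_add
  have hp := i.m_pos
  have hβ := codegen_shift_of_le i.shuffle.snd i.m
  have sβ := codegen_succ (shift i.shuffle.snd i.m) t
  have mo := i.mem_or t h h'
  have lβ := codegen_last _ _ i.beta_subset
  have mβ := codegen_monotone (shift i.shuffle.snd i.m) h
  have mβ' := codegen_monotone (shift i.shuffle.snd i.m) (show t + 1 ≤ n + 1 by omega)
  rw [card_shift, Shuffle.card_snd] at lβ
  rw [hβ _ le_rfl] at mβ
  simp only [lv, codegen_singleton, coface]
  grind

lemma rv_succ (t : ℕ) (h : i.m ≤ t) (h' : t ≤ n) :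
    i.rv (t + 1) = i.rv t + if t ∈ shift i.shuffle.snd i.m then 1 else 0 := by
  have hm := i.m_add
  have hp := i.m_pos
  have hα := codegen_shift_of_le i.shuffle.fst i.m
  have sα := codegen_succ (shift i.shuffle.fst i.m) t
  have mo := i.mem_or t h h'
  have mα := codegen_monotone (shift i.shuffle.fst i.m) h
  rw [hα _ le_rfl] at mα
  simp only [rv, coface]
  grind

lemma isPath : IsPath n i.a i.b i.lv i.rv := by
  have hm := i.m_add
  have hp := i.m_pos
  have hβ := codegen_shift_of_le i.shuffle.snd i.m
  have hα := codegen_shift_of_le i.shuffle.fst i.m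
  have lβ := codegen_last _ _ i.beta_subset
  rw [card_shift, Shuffle.card_snd] at lβ
  have l1 : ∀ t < i.m, i.lv t = t := by
    intro t ht
    simp only [lv, codegen_singleton, coface, hβ t ht.le]; grind
  have r1 : ∀ t < i.m, i.rv t = t := by
    intro t ht
    simp only [rv, coface, hα t ht.le]; grind
  have l2 : i.lv i.m = i.a := by
    simp only [lv, a, codegen_singleton, coface, hβ i.m le_rfl]; grind
  have r2 : i.rv i.m = i.b := by
    simp only [rv, b, coface, hα i.m le_rfl]; grind
  have e : i.a + 1 = i.m := by unfold a; omega
  have add : ∀ t, i.m ≤ t → t ≤ n + 1 → i.lv t + i.rv t + 1 = t + i.b := by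
    intro t ht
    induction t, ht using Nat.le_induction with
    | base => intro _; omega
    | succ t ht ih =>
      intro h
      have := ih (by omega)
      have := i.mem_or t ht (by omega)
      rw [i.lv_succ t ht (by omega), i.rv_succ t ht (by omega)]
      grind
  refine ⟨by unfold a b; omega, by unfold b; omega, fun t ht => l1 t (by omega),
    fun t ht => r1 t (by omega), by rw [e, l2], ?_, fun t h1 h2 => add t (by omega) h2, ?_, ?_⟩
  · simp only [lv, b, codegen_singleton, coface, lβ]; grind
  · intro t ht
    rcases lt_trichotomy (t + 1) i.m with h | h | h
    · rw [l1 t (by omega), l1 _ h]; omega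
    · rw [l1 t (by omega), h, l2]; omega
    · rw [i.lv_succ t (by omega) ht]; omega
  · intro t ht
    rcases lt_trichotomy (t + 1) i.m with h | h | h
    · rw [r1 t (by omega), r1 _ h]; omega
    · rw [r1 t (by omega), h, r2]; unfold b; omega
    · rw [i.rv_succ t (by omega) ht]; omega

end HIndex

lemma add_mem_shift {k : ℕ} {A : Finset (Fin k)} {m : ℕ} (x : Fin k) :
    m + x.val ∈ shift A m ↔ x ∈ A := by
  rw [mem_shift]
  constructor
  · rintro ⟨y, hy, h⟩
    rwa [← Fin.ext (show y.val = x.val by omega)]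
  · exact fun h => ⟨x, h, by omega⟩

lemma card_filter_val_lt_succ {k : ℕ} (A : Finset (Fin k)) (x : Fin k) :
    (A.filter (·.val < x.val + 1)).card =
      (A.filter (·.val < x.val)).card + if x ∈ A then 1 else 0 := by
  split_ifs with h
  · have : A.filter (·.val < x.val + 1) = insert x (A.filter (·.val < x.val)) := by
      ext y
      simp only [Finset.mem_filter, Finset.mem_insert, Fin.ext_iff]
      grind
    rw [this, Finset.card_insert_of_notMem (by simp)]
  · congr 1
    ext y
    simp only [Finset.mem_filter]
    grind

namespace HIndex

variable {n : ℕ} (i : HIndex n)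

lemma rv_eq_card (x : ℕ) (hx : x ≤ i.p + 1 + i.q) :
    i.rv (i.m + x) = i.b + (i.shuffle.snd.filter (·.val < x)).card := by
  have hm := i.m_add
  have e : i.a + 1 = i.m := by have := i.m_pos; unfold a; omega
  induction x with
  | zero => simpa [← e] using i.isPath.right_succ
  | succ x ih =>
    have h1 := card_filter_val_lt_succ i.shuffle.snd ⟨x, hx⟩
    have h2 := add_mem_shift (A := i.shuffle.snd) (m := i.m) ⟨x, hx⟩
    rw [← add_assoc, i.rv_succ _ (by omega) (by omega), ih (by omega), h1, add_assoc]
    simp only [h2]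

/-- At an `α`-step the height above `b` is the number of earlier elements of `β`, so the area counts
the inversions of the shuffle; the factor `(-1) ^ (m + 1)` is the parity of `a = m - 1`. -/
lemma sign_eq : i.sign = ((pathExponent n i.a i.b i.lv i.rv).negOnePow : ℤ) := by
  have hm := i.m_add
  have e : i.a + 1 = i.m := by have := i.m_pos; unfold a; omega
  have key : pathExponent n i.a i.b i.lv i.rv =
      i.a + ((∑ x ∈ i.shuffle.fst, (i.shuffle.snd.filter (· < x)).card : ℕ) : ℤ) := by
    rw [pathExponent, show n + 1 = i.m + (i.p + 1 + i.q) by omega, Finset.sum_range_add,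
      Finset.sum_eq_zero, zero_add, Finset.sum_range, Nat.cast_sum,
      ← Finset.sum_subset (Finset.subset_univ i.shuffle.fst)]
    · congr 1
      refine Finset.sum_congr rfl fun x hx => ?_
      rw [if_pos (by omega), i.lv_succ _ (by omega) (by omega), if_pos ((add_mem_shift x).2 hx),
        i.rv_eq_card _ x.2.le]
      have : i.shuffle.snd.filter (· < x) = i.shuffle.snd.filter (·.val < x.val) := rfl
      rw [this]
      push_cast
      ring
    · intro x _ hx
      rw [if_pos (by omega), i.lv_succ _ (by omega) (by omega),
        if_neg (mt (add_mem_shift x).1 hx)]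
      simp
    · intro x hx
      have := Finset.mem_range.1 hx
      exact if_neg (by omega)
  rw [sign, Shuffle.sign_eq, key, ← e, ← Nat.cast_add, Int.negOnePow_def, zpow_natCast]
  push_cast
  ring

/-- The corner recovers `p` and `q`, and the times at which the first coordinate moves recover `α`.
-/
lemma ext_of_eq {i j : HIndex n} (h : ∀ t ≤ n + 1, i.lv t = j.lv t) : i = j := by
  obtain ⟨ha, hb⟩ := i.isPath.eq_of_eq j.isPath h
  have hi := i.m_add
  have hj := j.m_add
  have hi' := i.m_pos
  have hj' := j.m_pos
  unfold a at ha
  unfold b at hb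
  have hm : i.m = j.m := by omega
  have hp : i.p = j.p := by omega
  have hq : i.q = j.q := by omega
  obtain ⟨⟨⟨p, q⟩, hpq⟩, s⟩ := i
  obtain ⟨⟨⟨p', q'⟩, hpq'⟩, s'⟩ := j
  obtain rfl : p = p' := Fin.ext hp
  obtain rfl : q = q' := Fin.ext hq
  congr 1
  refine Subtype.ext (Finset.ext fun x => ?_)
  have hx := x.2
  have h1 := lv_succ ⟨⟨(p, q), hpq⟩, s⟩ (m ⟨⟨(p, q), hpq⟩, s⟩ + x) (by omega)
    (by simp only [HIndex.p, HIndex.q] at *; omega)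
  have h2 := lv_succ ⟨⟨(p, q), hpq⟩, s'⟩ (m ⟨⟨(p, q), hpq⟩, s'⟩ + x) (by omega)
    (by simp only [HIndex.p, HIndex.q] at *; omega)
  have e1 : m ⟨⟨(p, q), hpq⟩, s⟩ + x ∈ shift (shuffle ⟨⟨(p, q), hpq⟩, s⟩).fst
    (m ⟨⟨(p, q), hpq⟩, s⟩) ↔ x ∈ s.1 := add_mem_shift (A := s.1) x
  have e2 : m ⟨⟨(p, q), hpq⟩, s'⟩ + x ∈ shift (shuffle ⟨⟨(p, q), hpq⟩, s'⟩).fst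
    (m ⟨⟨(p, q), hpq⟩, s'⟩) ↔ x ∈ s'.1 := add_mem_shift (A := s'.1) x
  rw [h _ (by simp only [HIndex.p, HIndex.q] at *; omega),
    h _ (by simp only [HIndex.p, HIndex.q] at *; omega)] at h1
  rw [hm] at h1 e1
  rw [h1] at h2
  simp only [e1, e2] at h2
  split_ifs at h2 <;> grind

end HIndex

/-- Every path comes from a summand of the homotopy. -/
lemma IsPath.exists_index {n a b : ℕ} {f g : ℕ → ℕ} (h : IsPath n a b f g) :
    ∃ i : HIndex n, i.a = a ∧ i.b = b ∧ ∀ t ≤ n + 1, i.lv t = f t ∧ i.rv t = g t := by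
  have hab := h.lt
  have hbn := h.le
  -- The shuffle consists of the times, counted from `m = a + 1`, at which the first coordinate
  -- moves; there are `b - a` of them.
  let α : Finset (Fin ((b - a - 1) + 1 + (n - b))) :=
    Finset.univ.filter fun x => f (a + 1 + x.val + 1) ≠ f (a + 1 + x.val)
  have hα : α.card = (b - a - 1) + 1 := by
    have key : ∀ N, a + 1 + N ≤ n + 1 → f (a + 1 + N) =
        a + ∑ x ∈ Finset.range N, if f (a + 1 + x + 1) ≠ f (a + 1 + x) then 1 else 0 := by
      intro N
      induction N with
      | zero => intro _; simpa using h.left_succ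
      | succ N ih =>
        intro hN
        have := ih (by omega)
        have := h.step (a + 1 + N) (by omega) (by omega)
        rw [Finset.sum_range_succ, ← add_assoc (a + 1)]
        grind
    have := key ((b - a - 1) + 1 + (n - b)) (by omega)
    rw [show a + 1 + ((b - a - 1) + 1 + (n - b)) = n + 1 by omega, h.left_last,
      Finset.sum_range] at this
    rw [Finset.card_filter]
    omega
  let i : HIndex n := ⟨⟨(⟨b - a - 1, by omega⟩, ⟨n - b, by omega⟩), by simp only; omega⟩, ⟨α, hα⟩⟩
  have hp : i.p = b - a - 1 := rfl
  have hq : i.q = n - b := rfl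
  have hm : i.m = a + 1 := by have := i.m_add; omega
  have ha : i.a = a := by unfold HIndex.a; omega
  have hb : i.b = b := by unfold HIndex.b; omega
  have hi := i.isPath
  have hl : ∀ t ≤ n + 1, i.lv t = f t := by
    intro t ht
    rcases Nat.lt_or_ge a t with h1 | h1
    · induction t, h1 using Nat.le_induction with
      | base => rw [h.left_succ, ← ha, hi.left_succ]
      | succ t h1 ih =>
        obtain ⟨x, rfl⟩ := Nat.exists_eq_add_of_le h1
        have e : a.succ + x ∈ shift i.shuffle.fst i.m ↔
            f (a + 1 + x + 1) ≠ f (a + 1 + x) := by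
          rw [hm]
          refine (add_mem_shift (A := α) (⟨x, by omega⟩ : Fin _)).trans ?_
          simp [α]
        rw [i.lv_succ _ (by omega) (by omega), ih (by omega)]
        have := h.step (a + 1 + x) (by omega) (by omega)
        simp only [e]
        grind
    · rw [h.left_diag t h1, hi.left_diag t (by omega)]
  refine ⟨i, ha, hb, fun t ht => ⟨hl t ht, ?_⟩⟩
  rcases Nat.lt_or_ge a t with h1 | h1
  · have := hi.add t (by omega) ht
    have := h.add t h1 ht
    have := hl t ht
    omega
  · rw [h.right_diag t h1, hi.right_diag t (by omega)]

/-! ### Compositions of paths -/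

lemma exists_eq_of_slow {v : ℕ → ℕ} {A B s : ℕ} (hAB : A ≤ B)
    (slow : ∀ t, A ≤ t → t < B → v (t + 1) ≤ v t + 1) (hA : v A ≤ s) (hB : s ≤ v B) :
    ∃ t, A ≤ t ∧ t ≤ B ∧ v t = s := by
  rcases hB.lt_or_eq with h | h
  · obtain ⟨t, h1, h2, h3, h4⟩ := HIndex.exists_step v A B s hA h hAB
    have := slow t h1 h2
    exact ⟨t, h1, h2.le, by omega⟩
  · exact ⟨B, hAB, le_rfl, h.symm⟩

lemma exists_succ_of_slow {v : ℕ → ℕ} {A B s : ℕ} (hAB : A ≤ B)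
    (slow : ∀ t, A ≤ t → t < B → v (t + 1) ≤ v t + 1) (hA : v A ≤ s) (hB : s < v B) :
    ∃ t, A ≤ t ∧ t < B ∧ v t = s ∧ v (t + 1) = s + 1 := by
  obtain ⟨t, h1, h2, h3, h4⟩ := HIndex.exists_step v A B s hA hB hAB
  have := slow t h1 h2
  exact ⟨t, h1, h2, by omega, by omega⟩

/-- A sequence that is constant along the constancy intervals of a slowly increasing sequence
factors through it. -/
lemma exists_factor {v ψ : ℕ → ℕ} {A B : ℕ} (hAB : A ≤ B)
    (slow : ∀ t, A ≤ t → t < B →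
      (v (t + 1) = v t ∧ ψ (t + 1) = ψ t) ∨ v (t + 1) = v t + 1) :
    ∃ F : ℕ → ℕ, ∀ t, A ≤ t → t ≤ B → F (v t) = ψ t := by
  suffices ∃ F : ℕ → ℕ, ∀ t, A ≤ t → t ≤ B → F (v t) = ψ t ∧ v t ≤ v B from
    this.imp fun F hF t h1 h2 => (hF t h1 h2).1
  induction B, hAB using Nat.le_induction with
  | base => exact ⟨fun _ => ψ A, fun t h1 h2 => by rw [show t = A by omega]; simp⟩
  | succ B hAB ih =>
    obtain ⟨F, hF⟩ := ih fun t h1 h2 => slow t h1 (by omega)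
    have hB := hF B hAB le_rfl
    rcases slow B hAB (by omega) with h | h
    · refine ⟨F, fun t h1 h2 => ?_⟩
      rcases h2.lt_or_eq with h2 | rfl
      · have := hF t h1 (by omega)
        omega
      · rw [h.1, h.2]; exact hB
    · refine ⟨fun s => if s = v (B + 1) then ψ (B + 1) else F s, fun t h1 h2 => ?_⟩
      rcases h2.lt_or_eq with h2 | rfl
      · have := hF t h1 (by omega)
        simp only
        rw [if_neg (by omega)]
        omega
      · simp

/-- The triple of sequences has no repeated value at consecutive places. -/
def NonDegen (N : ℕ) (φ ψ χ : ℕ → ℕ) : Prop :=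
  ∀ t ≤ N, ¬ (φ t = φ (t + 1) ∧ ψ t = ψ (t + 1) ∧ χ t = χ (t + 1))

/-- The first kind of composite: the triple `(f ∘ u, g ∘ u, g ∘ v)` of the two paths is
nondegenerate. -/
structure IsLeftPair (n a b a' b' : ℕ) (f g u v : ℕ → ℕ) : Prop where
  fst : IsPath n a b f g
  snd : IsPath (n + 1) a' b' u v
  lt : a < b'
  left_eq : ∀ s, b' ≤ s → s ≤ n + 1 → f s = b
  right_eq : ∀ s, b' ≤ s → s ≤ n + 1 → g s + 1 = s
  -- Since `g b' = b' - 1`, this says that `g` distinguishes the two ends of the jump of `v`.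
  jump : g a' + 1 < b'

/-- The second kind of composite: the triple `(f ∘ u, f ∘ v, g ∘ v)` of the two paths is
nondegenerate. -/
structure IsRightPair (n c d c' d' : ℕ) (f g u v : ℕ → ℕ) : Prop where
  fst : IsPath n c d f g
  snd : IsPath (n + 1) c' d' u v
  or : d' ≤ c ∨ c < c'
  left_eq : ∀ s, c' ≤ s → s ≤ d' → f s = f c' + (s - c')

/-- When `v` steps from `s` to `s + 1`, `u` rests, so only `g ∘ v` can prevent a repetition. Thus
`g` moves at every `s ≥ b'`, which leaves no steps for `f`. -/
lemma isLeftPair_of_nonDegen {n a b a' b' : ℕ} {f g u v : ℕ → ℕ} (h : IsPath n a b f g)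
    (h' : IsPath (n + 1) a' b' u v) (nd : NonDegen (n + 1) (f ∘ u) (g ∘ u) (g ∘ v)) :
    IsLeftPair n a b a' b' f g u v := by
  have := h.lt; have := h.le; have := h'.lt; have := h'.le
  have st : ∀ s, b' ≤ s → s ≤ n → g s ≠ g (s + 1) := by
    intro s h1 h2
    obtain ⟨t, t1, t2, t3, t4⟩ := exists_succ_of_slow (v := v) (A := a' + 1) (B := n + 2) (s := s)
      (by omega) (fun t h1 h2 => by have := h'.step t (by omega) (by omega); omega)
      (by rw [h'.right_succ]; omega) (by rw [h'.right_last]; omega)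
    have h3 := h'.step t (by omega) (by omega)
    have h4 := nd t (by omega)
    simp only [Function.comp] at h4
    rw [t3, t4] at h4
    have : u (t + 1) = u t := by omega
    rw [this] at h4
    tauto
  have st' : ∀ s, b' ≤ s → a < s → s ≤ n + 1 → f s = b := by
    intro s h1 h2 h3
    have : ∀ t, s ≤ t → t ≤ n + 1 → f t = f s := by
      intro t h4
      induction t, h4 using Nat.le_induction with
      | base => intro _; rfl
      | succ t h4 ih =>
        intro h5
        have := ih (by omega)
        have := st t (by omega) (by omega)
        have := h.step t (by omega) (by omega)
        omega
    rw [← this _ h3 le_rfl, h.left_last]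
  -- Otherwise `f` would already equal `b` at `a + 1`, where its value is `a`.
  have lt : a < b' := by
    by_contra hlt
    have := st' (a + 1) (by omega) (by omega) (by omega)
    rw [h.left_succ] at this
    omega
  have rt : ∀ s, b' ≤ s → s ≤ n + 1 → g s + 1 = s := by
    intro s h1 h2
    have := st' s h1 (by omega) h2
    have := h.add s (by omega) h2
    omega
  refine ⟨h, h', lt, fun s h1 h2 => st' s h1 (by omega) h2, rt, ?_⟩
  have h1 := nd a' (by omega)
  simp only [Function.comp, h'.left_diag a' le_rfl, h'.left_succ, h'.right_diag a' le_rfl,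
    h'.right_succ] at h1
  have h2 := monotone_upto h.right_mono (show a' ≤ b' by omega) (by omega)
  have h3 := rt b' le_rfl (by omega)
  simp only [true_and] at h1
  omega

/-- When `u` steps from `s` to `s + 1`, `v` rests, so `f` must move at each `s` in `[c', d')`. The
corner time `c`, at which `f` rests, cannot lie there. -/
lemma isRightPair_of_nonDegen {n c d c' d' : ℕ} {f g u v : ℕ → ℕ} (h : IsPath n c d f g)
    (h' : IsPath (n + 1) c' d' u v) (nd : NonDegen (n + 1) (f ∘ u) (f ∘ v) (g ∘ v)) :
    IsRightPair n c d c' d' f g u v := by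
  have := h.lt; have := h.le; have := h'.lt; have := h'.le
  have st : ∀ s, c' ≤ s → s < d' → f s ≠ f (s + 1) := by
    intro s h1 h2
    obtain ⟨t, t1, t2, t3, t4⟩ := exists_succ_of_slow (v := u) (A := c' + 1) (B := n + 2) (s := s)
      (by omega) (fun t h1 h2 => by have := h'.step t (by omega) (by omega); omega)
      (by rw [h'.left_succ]; omega) (by rw [h'.left_last]; omega)
    have h3 := h'.step t (by omega) (by omega)
    have h4 := nd t (by omega)
    simp only [Function.comp] at h4
    rw [t3, t4] at h4
    have : v (t + 1) = v t := by omega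
    rw [this] at h4
    tauto
  refine ⟨h, h', ?_, ?_⟩
  · by_contra hc
    have := st c (by omega) (by omega)
    rw [h.left_diag c le_rfl, h.left_succ] at this
    omega
  · intro s h1
    induction s, h1 using Nat.le_induction with
    | base => simp
    | succ s h1 ih =>
      intro h2
      have := ih (by omega)
      have := st s h1 (by omega)
      have := h.left_slow s (by omega)
      omega

/-! ### Recovering the two paths from the triple -/

namespace IsLeftPair

variable {n a b a' b' : ℕ} {f g u v : ℕ → ℕ} (h : IsLeftPair n a b a' b' f g u v)
include h

lemma last : f (u (n + 2)) = b ∧ g (u (n + 2)) + 1 = b' := by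
  have h1 := h.snd.left_last
  rw [h1]
  exact ⟨h.left_eq _ le_rfl h.snd.le, h.right_eq _ le_rfl h.snd.le⟩

lemma snd_right {t : ℕ} (h1 : a' < t) (h2 : t ≤ n + 2) : g (v t) + 1 = v t := by
  obtain ⟨-, -, h3, h4⟩ := h.snd.bounds t h1 h2
  exact h.right_eq _ h3 h4

/-- The second and third sequences agree through time `a'` and first differ at `a' + 1`, by the jump
condition. This gives one inequality; exchanging the two pairs gives the other. -/
lemma unique_aux {a₁ b₁ a₁' b₁' : ℕ} {f₁ g₁ u₁ v₁ : ℕ → ℕ}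
    (h₁ : IsLeftPair n a₁ b₁ a₁' b₁' f₁ g₁ u₁ v₁)
    (e : ∀ t ≤ n + 2, f (u t) = f₁ (u₁ t) ∧ g (u t) = g₁ (u₁ t) ∧ g (v t) = g₁ (v₁ t)) :
    a₁' ≤ a' := by
  have := h.snd.lt; have := h.snd.le; have := h₁.snd.lt; have := h₁.snd.le
  by_contra hlt
  have h1 := e (a' + 1) (by omega)
  rw [h₁.snd.left_diag _ (by omega), h₁.snd.right_diag _ (by omega), h.snd.left_succ,
    h.snd.right_succ] at h1
  have := h.right_eq b' le_rfl h.snd.le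
  have := h.jump
  omega

/-- A nondegenerate composite of the first kind is determined by its triple of sequences. -/
lemma unique {a₁ b₁ a₁' b₁' : ℕ} {f₁ g₁ u₁ v₁ : ℕ → ℕ}
    (h₁ : IsLeftPair n a₁ b₁ a₁' b₁' f₁ g₁ u₁ v₁)
    (e : ∀ t ≤ n + 2, f (u t) = f₁ (u₁ t) ∧ g (u t) = g₁ (u₁ t) ∧ g (v t) = g₁ (v₁ t)) :
    (∀ t ≤ n + 1, f t = f₁ t) ∧ ∀ t ≤ n + 2, u t = u₁ t := by
  have := h.snd.lt; have := h.snd.le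
  obtain rfl : a' = a₁' := le_antisymm
    (h₁.unique_aux h fun t ht => by
      obtain ⟨e1, e2, e3⟩ := e t ht
      exact ⟨e1.symm, e2.symm, e3.symm⟩)
    (h.unique_aux h₁ e)
  obtain ⟨e1, e2, -⟩ := e (n + 2) le_rfl
  have l := h.last
  have l₁ := h₁.last
  obtain rfl : b' = b₁' := by omega
  obtain rfl : b = b₁ := by omega
  -- After the corner `v` is one more than the third sequence, and `u` is then determined by the sum
  -- of the coordinates.
  have hu : ∀ t ≤ n + 2, u t = u₁ t := by
    intro t ht
    rcases Nat.lt_or_ge a' t with h1 | h1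
    · have := h.snd.add t h1 ht
      have := h₁.snd.add t h1 ht
      have := h.snd_right h1 ht
      have := h₁.snd_right h1 ht
      have := (e t ht).2.2
      omega
    · rw [h.snd.left_diag t h1, h₁.snd.left_diag t h1]
  refine ⟨fun s hs => ?_, hu⟩
  rcases Nat.lt_or_ge s b' with h1 | h1
  · obtain ⟨t, -, h2, rfl⟩ := exists_eq_of_slow (v := u) (A := 0) (B := n + 2) (s := s) (by omega)
      (fun t _ h2 => by have := h.snd.left_slow t (by omega); omega)
      (by rw [h.snd.left_diag 0 (by omega)]; omega) (by rw [h.snd.left_last]; exact h1.le)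
    rw [(e t h2).1, hu t h2]
  · rw [h.left_eq s h1 hs, h₁.left_eq s h1 hs]

end IsLeftPair

namespace IsRightPair

variable {n c d c' d' : ℕ} {f g u v : ℕ → ℕ} (h : IsRightPair n c d c' d' f g u v)
include h

lemma left_snd {t : ℕ} (h1 : c' < t) (h2 : t ≤ n + 2) : f (u t) = f c' + (u t - c') := by
  obtain ⟨h3, h4, -, -⟩ := h.snd.bounds t h1 h2
  exact h.left_eq _ h3 h4

lemma last : f (u (n + 2)) = f c' + (d' - c') := by
  have := h.snd.lt; have := h.snd.le
  rw [h.left_snd (by omega) le_rfl, h.snd.left_last]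

/-- Here the first two sequences agree through time `c'` and differ at `c' + 1`, because `f` has
slope one on `[c', d']`. -/
lemma unique_aux {c₁ d₁ c₁' d₁' : ℕ} {f₁ g₁ u₁ v₁ : ℕ → ℕ}
    (h₁ : IsRightPair n c₁ d₁ c₁' d₁' f₁ g₁ u₁ v₁)
    (e : ∀ t ≤ n + 2, f (u t) = f₁ (u₁ t) ∧ f (v t) = f₁ (v₁ t) ∧ g (v t) = g₁ (v₁ t)) :
    c₁' ≤ c' := by
  have := h.snd.lt; have := h.snd.le; have := h₁.snd.lt; have := h₁.snd.le
  by_contra hlt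
  have h1 := e (c' + 1) (by omega)
  rw [h₁.snd.left_diag _ (by omega), h₁.snd.right_diag _ (by omega), h.snd.left_succ,
    h.snd.right_succ] at h1
  have := h.left_eq d' (by omega) le_rfl
  omega

/-- A nondegenerate composite of the second kind is determined by its triple of sequences. -/
lemma unique {c₁ d₁ c₁' d₁' : ℕ} {f₁ g₁ u₁ v₁ : ℕ → ℕ}
    (h₁ : IsRightPair n c₁ d₁ c₁' d₁' f₁ g₁ u₁ v₁)
    (e : ∀ t ≤ n + 2, f (u t) = f₁ (u₁ t) ∧ f (v t) = f₁ (v₁ t) ∧ g (v t) = g₁ (v₁ t)) :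
    (∀ t ≤ n + 1, f t = f₁ t) ∧ ∀ t ≤ n + 2, u t = u₁ t := by
  have := h.snd.lt; have := h.snd.le
  obtain rfl : c' = c₁' := le_antisymm
    (h₁.unique_aux h fun t ht => by
      obtain ⟨e1, e2, e3⟩ := e t ht
      exact ⟨e1.symm, e2.symm, e3.symm⟩)
    (h.unique_aux h₁ e)
  obtain ⟨e1, -, -⟩ := e (n + 2) le_rfl
  obtain ⟨e2, -, -⟩ := e c' (by omega)
  rw [h.snd.left_diag _ le_rfl, h₁.snd.left_diag _ le_rfl] at e2
  have l := h.last
  have l₁ := h₁.last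
  have := h₁.snd.lt
  obtain rfl : d' = d₁' := by omega
  have hu : ∀ t ≤ n + 2, u t = u₁ t := by
    intro t ht
    rcases Nat.lt_or_ge c' t with h1 | h1
    · have := h.left_snd h1 ht
      have := h₁.left_snd h1 ht
      have := (e t ht).1
      have := h.snd.bounds t h1 ht
      have := h₁.snd.bounds t h1 ht
      omega
    · rw [h.snd.left_diag t h1, h₁.snd.left_diag t h1]
  refine ⟨fun s hs => ?_, hu⟩
  -- The values of `f` below `d'` are read from `f ∘ u`, and those from `d'` on from `f ∘ v`.
  rcases Nat.lt_or_ge s d' with h1 | h1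
  · obtain ⟨t, -, h2, rfl⟩ := exists_eq_of_slow (v := u) (A := 0) (B := n + 2) (s := s) (by omega)
      (fun t _ h2 => by have := h.snd.left_slow t (by omega); omega)
      (by rw [h.snd.left_diag 0 (by omega)]; omega) (by rw [h.snd.left_last]; exact h1.le)
    rw [(e t h2).1, hu t h2]
  · obtain ⟨t, h3, h2, rfl⟩ := exists_eq_of_slow (v := v) (A := c' + 1) (B := n + 2) (s := s)
      (by omega) (fun t h1 h2 => by have := h.snd.step t (by omega) (by omega); omega)
      (by rw [h.snd.right_succ]; omega) (by rw [h.snd.right_last]; omega)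
    have := h.snd.add t (by omega) h2
    have := h₁.snd.add t (by omega) h2
    have := hu t h2
    rw [(e t h2).2.1, show v t = v₁ t by omega]

end IsRightPair

/-- The two composites have the same triple of sequences, and their corners correspond. -/
structure Matched (n a b a' b' : ℕ) (f g u v : ℕ → ℕ) (c d c' d' : ℕ) (k l w z : ℕ → ℕ) :
    Prop where
  left : IsLeftPair n a b a' b' f g u v
  right : IsRightPair n c d c' d' k l w z
  eq_succ : b' = d + 1
  add_eq : d' + a = c' + b
  -- Each first path leaves the diagonal, in its composite, at the time where the second path of the
  -- other composite has its corner.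
  corner : u c' = a
  corner_succ : u (c' + 1) = a + 1
  corner' : z a' = c
  corner_succ' : z (a' + 1) = c + 1
  fst : ∀ t ≤ n + 2, k (w t) = f (u t)
  snd : ∀ t ≤ n + 2, k (z t) = g (u t)
  trd : ∀ t ≤ n + 2, l (z t) = g (v t)

/-! ### Refactoring a triple in the other order -/

lemma IsLeftPair.exists_matched {n a b a' b' : ℕ} {f g u v : ℕ → ℕ}
    (h : IsLeftPair n a b a' b' f g u v) :
    ∃ c d c' d' k l w z, Matched n a b a' b' f g u v c d c' d' k l w z := by
  have H1 := h.fst.lt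
  have H2 := h.fst.le
  have H3 := h.snd.lt
  have H4 := h.snd.le
  have H5 := h.lt
  have H6 := h.jump
  have ul : u (n + 2) = b' := h.snd.left_last
  have us := h.snd.left_slow
  have u0 := h.snd.left_diag 0 (by omega)
  have H7 := h.right_eq b' le_rfl H4
  have H8 := (h.fst.bounds b' H5 H4).2.2.1
  -- The new second path must jump when the first two sequences separate, that is, when `u` passes
  -- the corner of `(f, g)`.
  obtain ⟨c', -, hc1, hc2, hc3⟩ := exists_succ_of_slow (v := u) (A := 0) (B := n + 2) (s := a)
    (by omega) (fun t _ h2 => by have := us t (by omega); omega) (by omega) (by omega)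
  have um : ∀ s t, s ≤ t → t ≤ n + 2 → u s ≤ u t := fun s t h1 h2 =>
    monotone_upto h.snd.left_mono h1 h2
  have ule : ∀ t ≤ c', u t ≤ a := fun t ht => hc2 ▸ um t c' ht (by omega)
  have ugt : ∀ t, c' < t → t ≤ n + 2 → a < u t := fun t h1 h2 => by
    have := um (c' + 1) t h1 h2
    omega
  have ub : ∀ t ≤ n + 2, u t ≤ b' := fun t ht => h.snd.left_le t ht
  have cases : (a < a' ∧ c' = a) ∨ (a' ≤ a ∧ a' < c') := by
    rcases Nat.lt_or_ge a a' with h1 | h1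
    · left
      refine ⟨h1, ?_⟩
      by_contra h2
      have e1 := h.snd.left_diag a h1.le
      have e2 := h.snd.left_diag (a + 1) h1
      rcases Nat.lt_or_ge a c' with h3 | h3
      · have := um (a + 1) c' h3 (by omega)
        omega
      · have := um (c' + 1) a (by omega) (by omega)
        omega
    · right
      refine ⟨h1, ?_⟩
      by_contra h2
      have := um (c' + 1) (a' + 1) (by omega) (by omega)
      rw [h.snd.left_succ] at this
      omega
  have ga : (a < a' → g a' + f a' + 1 = a' + b ∧ b ≤ g a') ∧ (a' ≤ a → g a' = a') := by
    refine ⟨fun h1 => ?_, fun h1 => h.fst.right_diag _ h1⟩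
    have := h.fst.add a' h1 (by omega)
    have := h.fst.bounds a' h1 (by omega)
    omega
  have vb := h.snd.add c'
  have vl := h.snd.bounds c'
  have fb : ∀ t, c' < t → t ≤ n + 2 → a ≤ f (u t) ∧ f (u t) ≤ b ∧ f (u t) + g (u t) + 1 = u t + b
      ∧ b ≤ g (u t) := by
    intro t h1 h2
    have := h.fst.bounds (u t) (ugt t h1 h2) ((ub t h2).trans H4)
    have := h.fst.add (u t) (ugt t h1 h2) ((ub t h2).trans H4)
    omega
  have ult : ∀ t, 0 < t → t ≤ n + 2 → u t + 1 ≤ t ∨ (t ≤ a' ∧ u t = t) := by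
    intro t h1 h2
    rcases Nat.lt_or_ge a' t with h3 | h3
    · have := h.snd.add t h3 h2
      have := h.snd.bounds t h3 h2
      omega
    · exact Or.inr ⟨h3, h.snd.left_diag t h3⟩
  have fstep : ∀ t, c' < t → t ≤ n + 1 →
      (u (t + 1) = u t ∧ f (u (t + 1)) = f (u t) ∧ g (u (t + 1)) = g (u t)) ∨
      (u (t + 1) = u t + 1 ∧ ((f (u (t + 1)) = f (u t) + 1 ∧ g (u (t + 1)) = g (u t)) ∨
        (f (u (t + 1)) = f (u t) ∧ g (u (t + 1)) = g (u t) + 1))) := by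
    intro t h1 h2
    rcases us t h2 with h3 | h3
    · exact Or.inl ⟨h3, by rw [h3], by rw [h3]⟩
    · have := h.fst.step (u t) (ugt t h1 (by omega)) (by have := ub (t + 1) (by omega); omega)
      rw [← h3] at this
      exact Or.inr ⟨h3, this⟩
  -- the second path of the right pair
  obtain ⟨d', hd'⟩ : ∃ d', d' = c' + b - a := ⟨_, rfl⟩
  have hac : a ≤ c' := by
    rcases cases with h1 | h1
    · omega
    · have := ult c' (by omega) (by omega)
      omega
  have fu1 : f (u (c' + 1)) = a := by rw [hc3, h.fst.left_succ]
  have gu1 : g (u (c' + 1)) = b := by rw [hc3, h.fst.right_succ]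
  have fl := h.last
  have fl' : f (u (n + 1 + 1)) = b := fl.1
  have hR : IsPath (n + 1) c' d' (fun t => if t ≤ c' then t else c' + f (u t) - a)
      (fun t => if t ≤ c' then t else
        t + d' - 1 - (if t ≤ c' then t else c' + f (u t) - a)) := by
    refine IsPath.of_left (by omega) (by omega) (fun t ht => if_pos ht) ?_ ?_ ?_
    · rw [if_neg (by omega)]; omega
    · rw [if_neg (by omega)]; omega
    · intro t h1 h2
      rw [if_neg (by omega), if_neg (by omega)]
      have := fb t h1 (by omega)
      have := fstep t h1 h2
      omega
  generalize hw : (fun t => if t ≤ c' then t else c' + f (u t) - a) = w at hR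
  generalize hz : (fun t => if t ≤ c' then t else
        t + d' - 1 - (if t ≤ c' then t else c' + f (u t) - a)) = z at hR
  have w1 : ∀ t ≤ c', w t = t := hR.left_diag
  have z1 : ∀ t ≤ c', z t = t := hR.right_diag
  have w2 : ∀ t, c' < t → w t = c' + f (u t) - a := fun t ht => by
    rw [← hw]; exact if_neg (by omega)
  have z2 : ∀ t, c' < t → t ≤ n + 2 → z t + f (u t) + 1 = t + b := by
    intro t h1 h2
    have := hR.add t h1 h2
    have := w2 t h1
    have := fb t h1 h2
    omega
  have zm : ∀ s t, s ≤ t → t ≤ n + 2 → z s ≤ z t := fun s t h1 h2 =>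
    monotone_upto hR.right_mono h1 h2
  have zs : ∀ t, c' < t → t ≤ n + 1 → z (t + 1) ≤ z t + 1 := fun t h1 h2 => by
    have := hR.step t h1 h2
    omega
  clear hw hz
  -- If `z` rests after `c'`, then `f ∘ u` steps and hence `g ∘ u` rests, so `g ∘ u` is a function
  -- of `z`.
  obtain ⟨F, hF⟩ := exists_factor (v := z) (ψ := fun t => g (u t)) (A := c' + 1) (B := n + 2)
    (by omega) (fun t h1 h2 => by
      have := z2 t h1 (by omega)
      have := z2 (t + 1) (by omega) (by omega)
      have := fstep t h1 (by omega)
      omega)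
  have zd : z (c' + 1) = d' := hR.right_succ
  have zl : z (n + 2) = n + 1 := hR.right_last
  have Fd : F d' = b := by rw [← zd, hF _ le_rfl (by omega), gu1]
  have Fl : F (n + 1) + 1 = b' := by rw [← zl, hF _ (by omega) le_rfl]; exact fl.2
  have za : z a' = g a' := by
    rcases cases with ⟨h1, h2⟩ | ⟨h1, h2⟩
    · have := z2 a' (by omega) (by omega)
      rw [h.snd.left_diag a' le_rfl] at this
      have := ga.1 h1
      omega
    · rw [z1 a' h2.le, ga.2 h1]
  have za1 : z (a' + 1) = g a' + 1 := by
    rcases cases with ⟨h1, h2⟩ | ⟨h1, h2⟩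
    · have := z2 (a' + 1) (by omega) (by omega)
      rw [h.snd.left_succ] at this
      have := ga.1 h1
      omega
    · rw [z1 (a' + 1) h2, ga.2 h1]
  have Fa1 : a < a' → F (g a' + 1) = g a' := fun h1 => by
    rw [← za1, hF _ (by omega) (by omega), h.snd.left_succ]
  have Fdiag : a < a' → ∀ s, d' ≤ s → s ≤ g a' → F s = s := by
    intro h1 s h2 h3
    obtain ⟨t, t1, t2, rfl⟩ := exists_eq_of_slow (v := z) (A := c' + 1) (B := a') (s := s)
      (by omega) (fun t h1 h2 => zs t h1 (by omega)) (by omega) (by omega)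
    rw [hF t t1 (by omega)]
    have e := h.snd.left_diag t t2
    have := z2 t t1 (by omega)
    have := fb t t1 (by omega)
    omega
  have Fstep : ∀ s, d' ≤ s → s ≤ n → F s ≤ F (s + 1) ∧ F (s + 1) ≤ F s + 1 := by
    intro s h1 h2
    obtain ⟨t, t1, t2, t3, t4⟩ := exists_succ_of_slow (v := z) (A := c' + 1) (B := n + 2) (s := s)
      (by omega) (fun t h1 h2 => zs t h1 (by omega)) (by omega) (by omega)
    rw [← t4, ← t3, hF t t1 (by omega), hF (t + 1) (by omega) (by omega)]
    have := fstep t t1 (by omega)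
    omega
  -- All three pieces are forced: `w` and `z` are the identity up to `c'`, `k` needs slope one
  -- across the jump, and beyond it `k ∘ z = g ∘ u`.
  obtain ⟨k, hk⟩ : ∃ k : ℕ → ℕ, k = fun s => if s ≤ c' then u s else if s < d' then a + s - c'
    else F s := ⟨_, rfl⟩
  have k1 : ∀ s ≤ c', k s = u s := fun s hs => by rw [hk]; exact if_pos hs
  have k2 : ∀ s, c' ≤ s → s ≤ d' → k s = a + s - c' := by
    intro s h1 h2
    rw [hk]
    simp only
    split_ifs
    · rw [show s = c' by omega]; omega
    · rfl
    · rw [show s = d' by omega]; omega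
  have k3 : ∀ s, d' ≤ s → k s = F s := fun s h1 => by
    rw [hk]; simp only; rw [if_neg (by omega), if_neg (by omega)]
  clear hk
  have hP : IsPath n (g a') (b' - 1) k
      (fun s => if s ≤ g a' then s else s + (b' - 1) - 1 - k s) := by
    refine IsPath.of_left (by omega) (by omega) ?_ ?_ ?_ ?_
    · intro s hs
      rcases cases with ⟨h1, h2⟩ | ⟨h1, h2⟩
      · rcases Nat.lt_or_ge s d' with h3 | h3
        · rcases Nat.lt_or_ge s c' with h4 | h4
          · rw [k1 s h4.le, h.snd.left_diag s (by omega)]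
          · rw [k2 s h4 h3.le]; omega
        · rw [k3 s h3, Fdiag h1 s h3 hs]
      · have := ga.2 h1
        rw [k1 s (by omega), h.snd.left_diag s (by omega)]
    · rcases cases with ⟨h1, h2⟩ | ⟨h1, h2⟩
      · rw [k3 _ (by have := ga.1 h1; omega), Fa1 h1]
      · rw [ga.2 h1, k1 _ (by omega), h.snd.left_succ]
    · rw [k3 _ (by have := hR.le; omega)]; omega
    · intro s h1 h2
      rcases Nat.lt_or_ge s c' with h3 | h3
      · have h3 : s + 1 ≤ c' := h3
        rw [k1 s (by omega), k1 _ h3]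
        have := us s (by omega)
        omega
      · rcases Nat.lt_or_ge s d' with h4 | h4
        · rw [k2 s h3 h4.le, k2 (s + 1) (by omega) h4]; omega
        · rw [k3 s h4, k3 _ (by omega)]
          exact Fstep s h4 h2
  generalize hl : (fun s => if s ≤ g a' then s else s + (b' - 1) - 1 - k s) = l at hP
  clear hl
  refine ⟨g a', b' - 1, c', d', k, l, w, z, h, ⟨hP, hR, ?_, ?_⟩, by omega, by omega, hc2, hc3, za,
    za1, ?_, ?_, ?_⟩
  · rcases cases with ⟨h1, h2⟩ | ⟨h1, h2⟩
    · have := ga.1 h1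
      omega
    · have := ga.2 h1
      omega
  · intro s h1 h2
    rw [k2 s h1 h2, k2 c' le_rfl (by omega)]
    omega
  · intro t ht
    rcases Nat.lt_or_ge c' t with h1 | h1
    · have := fb t h1 ht
      rw [w2 t h1, k2 _ (by omega) (by omega)]
      omega
    · rw [w1 t h1, k1 t h1, h.fst.left_diag _ (ule t h1)]
  · intro t ht
    rcases Nat.lt_or_ge c' t with h1 | h1
    · rw [k3 _ (hR.bounds t h1 ht).2.2.1, hF t h1 ht]
    · rw [z1 t h1, k1 t h1, h.fst.right_diag _ (ule t h1)]
  · intro t ht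
    rcases Nat.lt_or_ge a' t with h1 | h1
    · have e1 := zm (a' + 1) t h1 ht
      have e2 := hP.add (z t) (by omega) (by have := zm t (n + 2) ht le_rfl; omega)
      have e3 := h.snd_right h1 ht
      have e4 := h.snd.add t h1 ht
      have e5 : k (z t) = g (u t) ∧ u t + z t = t + g (u t) := by
        rcases Nat.lt_or_ge c' t with h1 | h1
        · have := fb t h1 ht
          have := z2 t h1 ht
          rw [k3 _ (hR.bounds t h1 ht).2.2.1, hF t h1 ht]
          omega
        · rw [z1 t h1, k1 t h1, h.fst.right_diag _ (ule t h1)]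
          omega
      omega
    · have e1 := zm t a' h1 (by omega)
      rw [hP.right_diag _ (by omega), h.snd.right_diag t h1]
      rcases Nat.lt_or_ge c' t with h2 | h2
      · have := z2 t h2 ht
        have := fb t h2 ht
        have e2 : g (u t) = g t := by rw [h.snd.left_diag t h1]
        have := h.snd.left_diag t h1
        omega
      · rw [z1 t h2]
        have := ule t h2
        rw [h.snd.left_diag t h1] at this
        rw [h.fst.right_diag t this]

/-- This supplies surjectivity of the matching. Neither the signs nor the rigidity of the new pair
is needed: nondegeneracy depends only on the triple. -/
lemma IsRightPair.exists_left {n c d c' d' : ℕ} {k l w z : ℕ → ℕ}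
    (h : IsRightPair n c d c' d' k l w z) :
    ∃ a b a' b' f g u v, IsPath n a b f g ∧ IsPath (n + 1) a' b' u v ∧
      ∀ t ≤ n + 2, k (w t) = f (u t) ∧ k (z t) = g (u t) ∧ l (z t) = g (v t) := by
  have H1 := h.fst.lt
  have H2 := h.fst.le
  have H3 := h.snd.lt
  have H4 := h.snd.le
  have zl : z (n + 2) = n + 1 := h.snd.right_last
  have zm : ∀ s t, s ≤ t → t ≤ n + 2 → z s ≤ z t := fun s t h1 h2 =>
    monotone_upto h.snd.right_mono h1 h2
  have z1 := h.snd.right_diag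
  have w1 := h.snd.left_diag
  have z0 := z1 0 (by omega)
  have zc := h.snd.right_succ
  have wc := h.snd.left_succ
  have hstep := h.snd.step
  have hadd := h.snd.add
  have kdiag := h.fst.left_diag
  have ldiag := h.fst.right_diag
  have kadd := h.fst.add
  have kslow := h.fst.left_slow
  have kle := h.fst.left_le
  have klin := h.left_eq
  have ks := h.fst.left_succ
  have ls := h.fst.right_succ
  have zle : ∀ t ≤ n + 2, z t ≤ n + 1 := h.snd.right_le
  -- The new second path must jump when `z` passes the corner of `(k, l)`.
  obtain ⟨a', -, ha1, ha2, ha3⟩ := HIndex.exists_step z 0 (n + 2) c (by omega) (by omega)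
    (by omega)
  have cases : (c' < a' ∧ d' ≤ c) ∨ (c < c' ∧ a' = c) := by
    rcases h.or with h1 | h1
    · left
      refine ⟨?_, h1⟩
      by_contra h2
      have := zm (a' + 1) (c' + 1) (by omega) (by omega)
      omega
    · right
      refine ⟨h1, ?_⟩
      rcases lt_trichotomy a' c with h2 | h2 | h2
      · have := z1 (a' + 1) (by omega)
        omega
      · exact h2
      · have := zm (c + 1) a' h2 (by omega)
        rw [z1 (c + 1) h1] at this
        omega
  have za : z a' = c ∧ z (a' + 1) = c + 1 := by
    rcases cases with ⟨h1, h2⟩ | ⟨h1, rfl⟩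
    · have := hstep a' h1 (by omega)
      omega
    · exact ⟨z1 a' h1.le, z1 (a' + 1) h1⟩
  -- the values of the triple
  have zgt : ∀ t, a' < t → t ≤ n + 2 → c < z t := fun t h1 h2 => by
    have := zm (a' + 1) t h1 h2
    omega
  have zle' : ∀ t ≤ a', z t ≤ c := fun t h1 => by
    have := zm t a' h1 (by omega)
    omega
  have sum : ∀ t, a' < t → t ≤ n + 2 → k (z t) + l (z t) + 1 = z t + d ∧ c ≤ k (z t) ∧
      d ≤ l (z t) ∧ l (z t) ≤ n ∧ k (z t) ≤ d := by
    intro t h1 h2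
    have := kadd (z t) (zgt t h1 h2) (zle t h2)
    have := h.fst.bounds (z t) (zgt t h1 h2) (zle t h2)
    omega
  have lc' : c < c' → l d' = l c' := by
    intro h1
    have e1 := kadd c' h1 (by omega)
    have e2 := kadd d' (by omega) H4
    have e3 := klin d' (by omega) le_rfl
    omega
  obtain ⟨b, hb⟩ : ∃ b, b = k d' := ⟨_, rfl⟩
  obtain ⟨a, ha⟩ : ∃ a, a = k c' := ⟨_, rfl⟩
  have hab : b = a + (d' - c') := by rw [ha, hb, klin d' (by omega) le_rfl]
  have kw : ∀ t, c' < t → t ≤ n + 2 → k (w t) + c' = a + w t ∧ a ≤ k (w t) ∧ k (w t) ≤ b ∧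
      w t + z t + 1 = t + d' := by
    intro t h1 h2
    have e1 := h.snd.bounds t h1 h2
    have e2 := klin (w t) e1.1 e1.2.1
    have e3 := hadd t h1 h2
    omega
  -- The time `c'` is separate because `z` jumps there; `l ∘ z` still rests, as `l` is constant on
  -- `[c', d']`.
  have kz : ∀ t, a' < t → t ≤ n + 1 →
      (l (z (t + 1)) = l (z t) + 1 ∧ k (w (t + 1)) = k (w t) ∧ k (z (t + 1)) = k (z t)) ∨
      (l (z (t + 1)) = l (z t) ∧ t = c' ∧ k (w (t + 1)) = k (w t)) ∨
      (l (z (t + 1)) = l (z t) ∧ t ≠ c' ∧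
        (k (w (t + 1)) = k (w t) ∨ k (w (t + 1)) = k (w t) + 1) ∧ (t < c' →
          k (w (t + 1)) = k (w t) + 1)) := by
    intro t h1 h2
    rcases lt_trichotomy t c' with h3 | h3 | h3
    · have hct := zgt t h1 (by omega)
      rw [z1 t h3.le] at hct
      rw [z1 t h3.le, z1 (t + 1) h3, w1 t h3.le, w1 (t + 1) h3]
      have := h.fst.step t hct (by omega)
      omega
    · subst h3
      rw [zc, z1 t le_rfl, wc, w1 t le_rfl]
      have := lc' (by omega)
      omega
    · rcases hstep t h3 h2 with h4 | h4
      · have := kw t h3 (by omega)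
        have := kw (t + 1) (by omega) (by omega)
        rw [h4.2]
        omega
      · have := h.fst.step (z t) (zgt t h1 (by omega)) (by have := zle (t + 1) (by omega); omega)
        rw [h4.1, h4.2]
        omega
  have zn : l (z (n + 2)) = n := by rw [zl, h.fst.right_last]
  have lub : ∀ t, a' < t → t ≤ n + 2 → l (z t) + a' + 1 ≤ t + d := by
    intro t h1
    induction t, h1 using Nat.le_induction with
    | base => intro _; rw [za.2, ls]; omega
    | succ t h1 ih =>
      intro h2
      have := ih (by omega)
      have := kz t h1 (by omega)
      omega
  -- The formula comes from the required `v = l ∘ z + 1` after the corner and from `u t + v t + 1 =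
  -- t + (d + 1)`.
  have hU : IsPath (n + 1) a' (d + 1) (fun t => if t ≤ a' then t else t + d - 1 - l (z t))
      (fun t => if t ≤ a' then t else t + (d + 1) - 1 -
        (if t ≤ a' then t else t + d - 1 - l (z t))) := by
    refine IsPath.of_left ?_ (by omega) (fun t ht => if_pos ht) ?_ ?_ ?_
    · rcases cases with ⟨h1, h2⟩ | ⟨h1, h2⟩
      · have := kw a' h1 (by omega)
        have := kdiag d' h2
        have := kdiag c' (by omega)
        omega
      · omega
    · rw [if_neg (by omega), za.2, ls]; omega
    · rw [if_neg (by omega), zn]; omega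
    · intro t h1 h2
      rw [if_neg (by omega), if_neg (by omega)]
      have := sum t h1 (by omega)
      have := sum (t + 1) (by omega) (by omega)
      have := kz t h1 h2
      have := lub t h1 (by omega)
      omega
  generalize hu : (fun t => if t ≤ a' then t else t + d - 1 - l (z t)) = u at hU
  generalize hv : (fun t => if t ≤ a' then t else t + (d + 1) - 1 -
        (if t ≤ a' then t else t + d - 1 - l (z t))) = v at hU
  have u1 : ∀ t ≤ a', u t = t := hU.left_diag
  have v1 : ∀ t ≤ a', v t = t := hU.right_diag
  have u2 : ∀ t, a' < t → t ≤ n + 2 → u t + l (z t) + 1 = t + d := by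
    intro t h1 h2
    have := lub t h1 h2
    have : u t = t + d - 1 - l (z t) := by rw [← hu]; exact if_neg (by omega)
    omega
  have v2 : ∀ t, a' < t → t ≤ n + 2 → v t = l (z t) + 1 := by
    intro t h1 h2
    have := u2 t h1 h2
    have := hU.add t h1 h2
    omega
  clear hu hv
  have us := hU.left_slow
  have ul : u (n + 2) = d + 1 := hU.left_last
  have um : ∀ s t, s ≤ t → t ≤ n + 2 → u s ≤ u t := fun s t h1 h2 =>
    monotone_upto hU.left_mono h1 h2
  have uc : u c' = a ∧ u (c' + 1) = a + 1 := by
    rcases cases with ⟨h1, h2⟩ | ⟨h1, h2⟩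
    · rw [u1 c' h1.le, u1 (c' + 1) h1, ha, kdiag c' (by omega)]
      omega
    · have e1 := u2 c' (by omega) (by omega)
      have e2 := u2 (c' + 1) (by omega) (by omega)
      have e3 := sum c' (by omega) (by omega)
      have := lc' h1
      rw [z1 c' le_rfl] at e1 e3
      rw [zc] at e2
      omega
  have below : ∀ t ≤ c', k (w t) = u t ∧ k (z t) = u t := by
    intro t ht
    have e1 := z1 t ht
    rw [w1 t ht, e1, and_self]
    rcases Nat.lt_or_ge a' t with h1 | h1
    · have := sum t h1 (by omega)
      have := u2 t h1 (by omega)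
      rw [e1] at *
      omega
    · rw [u1 t h1, kdiag t (by have := zle' t h1; omega)]
  obtain ⟨F, hF⟩ := exists_factor (v := u) (ψ := fun t => k (w t)) (A := 0) (B := n + 2)
    (by omega) (fun t _ h2 => by
      rcases lt_trichotomy t a' with h3 | rfl | h3
      · rw [u1 t h3.le, u1 (t + 1) h3]
        omega
      · left
        rw [u1 t le_rfl, hU.left_succ]
        refine ⟨rfl, ?_⟩
        rcases cases with ⟨h1, h2⟩ | ⟨h1, rfl⟩
        · have := hstep t h1 (by omega)
          rw [show w (t + 1) = w t by omega]
        · rw [w1 _ h1.le, w1 _ h1, kdiag t le_rfl, ks]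
      · have := kz t h3 (by omega)
        have := u2 t h3 (by omega)
        have := u2 (t + 1) (by omega) (by omega)
        omega)
  have Fd : F (d + 1) = b := by
    rw [← ul, hF _ (by omega) le_rfl, hb]
    exact congrArg k h.snd.left_last
  have had : a ≤ d := ha ▸ kle c' (by omega)
  have hbd : b ≤ d := hb ▸ kle d' (by omega)
  -- The map `u` only reaches `d + 1`; beyond, `f` rests at `b`, as rigidity of the first kind
  -- demands.
  obtain ⟨f, hf⟩ : ∃ f : ℕ → ℕ, f = fun s => if s ≤ d then F s else b := ⟨_, rfl⟩
  have f1 : ∀ s ≤ d + 1, f s = F s := by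
    intro s hs
    rw [hf]
    simp only
    split_ifs with h1
    · rfl
    · rw [show s = d + 1 by omega, Fd]
  have f2 : ∀ s, d < s → f s = b := fun s hs => by rw [hf]; exact if_neg (by omega)
  clear hf
  have hP : IsPath n a b f (fun s => if s ≤ a then s else s + b - 1 - f s) := by
    refine IsPath.of_left (by omega) (by omega) ?_ ?_ (f2 _ (by omega)) ?_
    · intro s hs
      obtain ⟨t, -, t1, rfl⟩ := exists_eq_of_slow (v := u) (A := 0) (B := c') (s := s)
        (by omega) (fun t h1 h2 => by have := us t (by omega); omega)
        (by rw [u1 0 (by omega)]; omega) (by omega)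
      rw [f1 _ (by omega), hF t (by omega) (by omega), (below t t1).1]
    · rw [f1 _ (by omega), ← uc.2, hF _ (by omega) (by omega), wc, ha]
    · intro s h1 h2
      rcases Nat.lt_or_ge d s with h3 | h3
      · rw [f2 s h3, f2 (s + 1) (by omega)]
        omega
      · obtain ⟨t, t1, t2, t3, t4⟩ := exists_succ_of_slow (v := u) (A := c' + 1) (B := n + 2)
          (s := s) (by omega) (fun t h1 h2 => by have := us t (by omega); omega)
          (by omega) (by omega)
        rw [f1 s (by omega), f1 (s + 1) (by omega), ← t4, ← t3, hF t (by omega) (by omega),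
          hF (t + 1) (by omega) (by omega)]
        have := kw t t1 (by omega)
        have := kw (t + 1) (by omega) (by omega)
        have := hstep t t1 (by omega)
        omega
  generalize hg : (fun s => if s ≤ a then s else s + b - 1 - f s) = g at hP
  clear hg
  have ule : ∀ t ≤ n + 2, u t ≤ d + 1 := hU.left_le
  have h1 : ∀ t ≤ n + 2, k (w t) = f (u t) := fun t ht => by
    rw [f1 _ (ule t ht), hF t (by omega) ht]
  have h2 : ∀ t ≤ n + 2, k (z t) = g (u t) := by
    intro t ht
    rcases Nat.lt_or_ge c' t with h2 | h2
    · have e1 := um (c' + 1) t h2 ht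
      have e2 := hP.add (u t) (by omega) (by have := ule t ht; omega)
      have e3 := h1 t ht
      have e4 := kw t h2 ht
      rcases Nat.lt_or_ge a' t with h3 | h3
      · have := u2 t h3 ht
        have := sum t h3 ht
        omega
      · have := u1 t h3
        have := kdiag (z t) (zle' t h3)
        omega
    · rw [hP.right_diag _ (by have := um t c' h2 (by omega); omega), (below t h2).2]
  refine ⟨a, b, a', d + 1, f, g, u, v, hP, hU, fun t ht => ⟨h1 t ht, h2 t ht, ?_⟩⟩
  rcases Nat.lt_or_ge a' t with h3 | h3
  · have e1 := v2 t h3 ht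
    have e2 := sum t h3 ht
    have e3 := hP.add (v t) (by omega) (by omega)
    have e4 := f2 (v t) (by omega)
    omega
  · have e1 := h2 t ht
    rw [u1 t h3, kdiag _ (zle' t h3)] at e1
    rw [v1 t h3, ← e1, ldiag _ (zle' t h3)]

/-- The partial sums in the exponent of the sign of a path. -/
def pathSum (a b : ℕ) (f g : ℕ → ℕ) (N : ℕ) : ℤ :=
  ∑ t ∈ Finset.range N, if a < t then ((f (t + 1) : ℤ) - f t) * (g t - b) else 0

lemma pathExponent_eq (n a b : ℕ) (f g : ℕ → ℕ) :
    pathExponent n a b f g = a + pathSum a b f g (n + 1) := rfl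

lemma pathSum_succ (a b : ℕ) (f g : ℕ → ℕ) (N : ℕ) :
    pathSum a b f g (N + 1) = pathSum a b f g N +
      if a < N then ((f (N + 1) : ℤ) - f N) * (g N - b) else 0 :=
  Finset.sum_range_succ _ _

lemma pathSum_of_le {a b : ℕ} {f g : ℕ → ℕ} {N : ℕ} (h : N ≤ a + 1) :
    pathSum a b f g N = 0 :=
  Finset.sum_eq_zero fun t ht => if_neg (by have := Finset.mem_range.1 ht; omega)

/-! ### Comparison of the signs of matched composites -/

namespace Matched

variable {n a b a' b' : ℕ} {f g u v : ℕ → ℕ} {c d c' d' : ℕ} {k l w z : ℕ → ℕ}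
  (h : Matched n a b a' b' f g u v c d c' d' k l w z)
include h

/-- Second paths are the identity before their corners, so the corner met first keeps its position
when the order is exchanged. -/
lemma cases : (a < a' ∧ c' = a ∧ d' ≤ c) ∨ (a' ≤ a ∧ a' < c' ∧ c = a') := by
  have H3 := h.left.snd.lt
  have H4 := h.left.snd.le
  have H5 := h.right.snd.lt
  have H6 := h.right.snd.le
  have um : ∀ s t, s ≤ t → t ≤ n + 2 → u s ≤ u t := fun s t h1 h2 =>
    monotone_upto h.left.snd.left_mono h1 h2
  have zm : ∀ s t, s ≤ t → t ≤ n + 2 → z s ≤ z t := fun s t h1 h2 =>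
    monotone_upto h.right.snd.right_mono h1 h2
  have e1 := h.corner
  have e2 := h.corner_succ
  have e3 := h.corner'
  have e4 := h.corner_succ'
  rcases h.right.or with h1 | h1
  · left
    have h2 : c' < a' := by
      by_contra h2
      rw [h.right.snd.right_diag _ (by omega)] at e3
      omega
    rw [h.left.snd.left_diag _ h2.le] at e1
    omega
  · right
    have h2 : a' < c' := by
      by_contra h2
      have := zm c' a' (by omega) (by omega)
      rw [h.right.snd.right_diag _ le_rfl] at this
      omega
    rw [h.right.snd.right_diag _ h2.le] at e3
    have := um a' c' h2.le (by omega)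
    rw [h.left.snd.left_diag _ le_rfl] at this
    omega

/-- Since `u` rests or advances by one, the area of the first path can be accumulated in the time of
the composite; this makes the four areas comparable term by term. -/
lemma pathSum_left_succ {t : ℕ} (ht : t ≤ n + 1) :
    pathSum a b f g (u (t + 1)) = pathSum a b f g (u t) +
      if c' < t then ((f (u (t + 1)) : ℤ) - f (u t)) * (g (u t) - b) else 0 := by
  have H := h.right.snd.lt
  have H' := h.right.snd.le
  have iff : a < u t ↔ c' < t := by
    constructor
    · intro h1
      by_contra h2
      have := monotone_upto h.left.snd.left_mono (show t ≤ c' by omega) (by omega)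
      rw [h.corner] at this
      omega
    · intro h1
      have := monotone_upto h.left.snd.left_mono (show c' + 1 ≤ t from h1) (by omega)
      rw [h.corner_succ] at this
      omega
  rcases h.left.snd.left_slow t ht with h1 | h1
  · rw [h1]; simp
  · rw [h1, pathSum_succ]
    simp only [iff]

/-- Across the jump `k` has slope one. Past the corner of `(k, l)` this makes `l` constant, so the
area is a rectangle; before that corner there is no area. -/
lemma pathSum_right_jump (s : ℕ) (h1 : c' ≤ s) (h2 : s ≤ d') :
    pathSum c d k l s = pathSum c d k l c' +
      if c < c' then ((s : ℤ) - c') * (l c' - d) else 0 := by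
  have H' := h.right.snd.le
  by_cases h3 : c < c'
  · rw [if_pos h3]
    induction s, h1 using Nat.le_induction with
    | base => simp
    | succ s h1 ih =>
      have e1 := h.right.left_eq s h1 (by omega)
      have e2 := h.right.left_eq (s + 1) (by omega) h2
      have e3 := h.right.fst.add s (by omega) (by omega)
      have e4 := h.right.fst.add c' (by omega) (by omega)
      rw [pathSum_succ, ih (by omega), if_pos (by omega), show l s = l c' by omega,
        show k (s + 1) = k s + 1 by omega]
      push_cast
      ring
  · have := h.right.or
    rw [if_neg h3, pathSum_of_le (by omega), pathSum_of_le (by omega), add_zero]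

lemma pathSum_right_succ {t : ℕ} (ht : t ≤ n + 1) :
    pathSum c d k l (z (t + 1)) = pathSum c d k l (z t) +
      if a' < t then ((k (z (t + 1)) : ℤ) - k (z t)) * (l (z t) - d) else 0 := by
  have H := h.left.snd.lt
  have H' := h.left.snd.le
  have H1 := h.right.snd.lt
  have iff : c < z t ↔ a' < t := by
    constructor
    · intro h1
      by_contra h2
      have := monotone_upto h.right.snd.right_mono (show t ≤ a' by omega) (by omega)
      rw [h.corner'] at this
      omega
    · intro h1
      have := monotone_upto h.right.snd.right_mono (show a' + 1 ≤ t from h1) (by omega)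
      rw [h.corner_succ'] at this
      omega
  rcases lt_trichotomy t c' with h1 | rfl | h1
  · have e1 := h.right.snd.right_diag t h1.le
    rw [h.right.snd.right_diag (t + 1) h1, pathSum_succ]
    rw [e1] at iff ⊢
    simp only [iff]
  · have e1 := h.right.snd.right_diag t le_rfl
    rw [e1] at iff ⊢
    rw [h.right.snd.right_succ, h.pathSum_right_jump d' H1.le le_rfl,
      h.right.left_eq d' H1.le le_rfl]
    simp only [iff]
    push_cast [Nat.cast_sub H1.le]
    simp
  · rcases h.right.snd.step t h1 ht with h2 | h2
    · rw [h2.2]; simp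
    · rw [h2.2, pathSum_succ]
      simp only [iff]

lemma values_right {t : ℕ} (h1 : c' < t) (h2 : t ≤ n + 2) :
    (w t : ℤ) = c' + f (u t) - a ∧ (z t : ℤ) = t + b - 1 - f (u t) ∧
      (g (u t) : ℤ) = u t + b - 1 - f (u t) := by
  have e0 := h.add_eq
  have e1 := h.right.left_snd h1 h2
  have e2 := h.right.snd.bounds t h1 h2
  have e3 := h.right.snd.add t h1 h2
  have e4 := monotone_upto h.left.snd.left_mono (show c' + 1 ≤ t from h1) (by omega)
  have e5 := h.fst t h2
  have e6 := h.fst c' (by omega)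
  rw [h.corner_succ] at e4
  rw [h.corner, h.left.fst.left_diag a le_rfl, h.right.snd.left_diag c' le_rfl] at e6
  have e7 := h.left.fst.add (u t) (by omega)
    ((h.left.snd.left_le t h2).trans h.left.snd.le)
  omega

lemma values_left {t : ℕ} (h1 : a' < t) (h2 : t ≤ n + 2) :
    (v t : ℤ) = t + b' - 1 - u t ∧ (g (v t) : ℤ) = t + d - 1 - u t := by
  have e0 := h.eq_succ
  have e1 := h.left.snd_right h1 h2
  have e2 := h.left.snd.add t h1 h2
  omega

/-- The difference of the partial sums of the exponents, in the first case. -/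
lemma pathSum_diff_of_lt (ha : a < a') (t : ℕ) (ht : t ≤ n + 2) :
    pathSum c d k l (z t) + pathSum c' d' w z t -
      (pathSum a b f g (u t) + pathSum a' b' u v t) =
    if t ≤ a' then 0 else (f (u t) : ℤ) - f a' := by
  have hc : (c' : ℤ) = a := by have := h.cases; omega
  have hd : (d' : ℤ) = b := by have := h.add_eq; omega
  induction t with
  | zero =>
    rw [h.right.snd.right_diag 0 (by omega), h.left.snd.left_diag 0 (by omega)]
    simp [pathSum]
  | succ t ih =>
    have ih := ih (by omega)
    rw [h.pathSum_left_succ (by omega), h.pathSum_right_succ (by omega), pathSum_succ,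
      pathSum_succ, h.snd t (by omega), h.trd t (by omega), h.snd (t + 1) (by omega)]
    rcases Nat.lt_or_ge c' t with h1 | h1
    · obtain ⟨e1, e2, e3⟩ := h.values_right h1 (by omega)
      obtain ⟨e1', -, e3'⟩ := h.values_right (show c' < t + 1 by omega) ht
      rw [if_pos h1, if_pos h1, e1, e1', e2, e3]
      rcases Nat.lt_or_ge a' t with h2 | h2
      · obtain ⟨e4, e5⟩ := h.values_left h2 (by omega)
        rw [if_neg (by omega)] at ih
        rw [if_pos h2, if_pos h2, if_neg (by omega), e3', e4, e5, hc, hd]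
        linear_combination ih
      · rw [if_pos h2] at ih
        rw [if_neg (by omega), if_neg (by omega), h.left.snd.left_diag t h2, hc, hd]
        rw [h.left.snd.left_diag t h2] at ih
        split_ifs with h3
        · linear_combination ih
        · rw [show t = a' by omega, h.left.snd.left_succ]
          rw [show t = a' by omega] at ih
          linear_combination ih
    · rw [if_neg (by omega), if_neg (by omega), if_neg (by omega), if_neg (by omega),
        if_pos (by omega)]
      rw [if_pos (by omega)] at ih
      linear_combination ih

/-- The difference of the partial sums of the exponents, in the second case. -/
lemma pathSum_diff_of_le (ha : a' ≤ a) (t : ℕ) (ht : t ≤ n + 2) :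
    pathSum c d k l (z t) + pathSum c' d' w z t -
      (pathSum a b f g (u t) + pathSum a' b' u v t) =
    if t ≤ c' then 0 else
      ((b : ℤ) - a - 1) * (c' - 1 - a) + (f (u t) - a) * (1 - c' + a) := by
  have H := h.right.snd.lt
  have H' := h.right.snd.le
  have hc : a' < c' := by have := h.cases; omega
  have hd : (d' : ℤ) = c' + b - a := by have := h.add_eq; omega
  induction t with
  | zero =>
    rw [h.right.snd.right_diag 0 (by omega), h.left.snd.left_diag 0 (by omega)]
    simp [pathSum]
  | succ t ih =>
    have ih := ih (by omega)
    rw [h.pathSum_left_succ (by omega), h.pathSum_right_succ (by omega), pathSum_succ,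
      pathSum_succ, h.snd t (by omega), h.trd t (by omega), h.snd (t + 1) (by omega)]
    rcases Nat.lt_or_ge a' t with h2 | h2
    · obtain ⟨e4, e5⟩ := h.values_left h2 (by omega)
      rw [if_pos h2, if_pos h2, e4, e5]
      have ule : ∀ s ≤ c', g (u s) = u s := by
        intro s hs
        have := monotone_upto h.left.snd.left_mono hs (by omega)
        rw [h.corner] at this
        exact h.left.fst.right_diag _ this
      rcases lt_trichotomy t c' with h1 | h1 | h1
      · rw [if_pos h1.le] at ih
        rw [if_neg (by omega), if_neg (by omega), if_pos (by omega), ule t h1.le, ule (t + 1) h1]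
        linear_combination ih
      · rw [if_pos h1.le] at ih
        rw [if_neg (by omega), if_neg (by omega), if_neg (by omega), ule t h1.le]
        rw [h1] at ih ⊢
        rw [h.corner] at ih
        rw [h.corner_succ, h.corner, h.left.fst.right_succ, h.left.fst.left_succ]
        push_cast
        linear_combination ih
      · obtain ⟨e1, e2, e3⟩ := h.values_right h1 (by omega)
        obtain ⟨e1', -, e3'⟩ := h.values_right (show c' < t + 1 by omega) ht
        rw [if_neg (by omega)] at ih
        rw [if_pos h1, if_pos h1, if_neg (by omega), e1, e1', e2, e3, e3', hd]
        linear_combination ih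
    · rw [if_neg (by omega), if_neg (by omega), if_neg (by omega), if_neg (by omega),
        if_pos (by omega)]
      rw [if_pos (by omega)] at ih
      linear_combination ih

/-- The composite only sees the area up to `u (n + 2) = b'`, but `f` rests afterwards, so nothing is
lost. -/
lemma pathSum_left_last : pathSum a b f g (n + 1) = pathSum a b f g b' := by
  have key : ∀ N, b' ≤ N → N ≤ n + 1 → pathSum a b f g N = pathSum a b f g b' := by
    intro N hN
    induction N, hN using Nat.le_induction with
    | base => intro _; rfl
    | succ N hN ih =>
      intro h1
      rw [pathSum_succ, ih (by omega), h.left.left_eq N hN (by omega),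
        h.left.left_eq (N + 1) (by omega) h1]
      simp
  exact key _ h.left.snd.le le_rfl

/-- Matched composites have opposite signs. -/
lemma odd_exponent : Odd (pathExponent n c d k l + pathExponent (n + 1) c' d' w z -
    (pathExponent n a b f g + pathExponent (n + 1) a' b' u v)) := by
  have H := h.left.snd.lt
  have H' := h.left.snd.le
  have H1 := h.right.snd.lt
  have H1' := h.right.snd.le
  have zl : z (n + 2) = n + 1 := h.right.snd.right_last
  have ul : u (n + 2) = b' := h.left.snd.left_last
  have fl := h.left.last.1
  simp only [pathExponent_eq, h.pathSum_left_last]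
  rcases h.cases with ⟨h1, h2, -⟩ | ⟨h1, h2, h3⟩
  · have e := h.pathSum_diff_of_lt h1 (n + 2) le_rfl
    rw [if_neg (by omega), fl, zl, ul] at e
    have e1 := h.snd a' (by omega)
    rw [h.corner', h.right.fst.left_diag c le_rfl, h.left.snd.left_diag a' le_rfl] at e1
    have e2 := h.left.fst.add a' h1 (by omega)
    have e3 : (c : ℤ) = a' + b - 1 - f a' := by omega
    -- The areas differ by `b - f a'`, and the corner terms by `c - a' = b - 1 - f a'` because `c' =
    -- a`.
    refine ⟨b - f a' - 1, ?_⟩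
    have e4 : (c' : ℤ) = a := by omega
    linear_combination e + e3 + e4
  · have e := h.pathSum_diff_of_le h1 (n + 2) le_rfl
    rw [if_neg (by omega), fl, zl, ul] at e
    -- The areas differ by `1 + a - c'`, and the corner terms by `c' - a` because `c = a'`: in total
    -- exactly `1`.
    refine ⟨0, ?_⟩
    have e4 : (c : ℤ) = a' := by omega
    linear_combination e + e4

end Matched

lemma pathExponent_congr {n a b : ℕ} {f g f' g' : ℕ → ℕ}
    (h : ∀ t ≤ n + 1, f t = f' t ∧ g t = g' t) :
    pathExponent n a b f g = pathExponent n a b f' g' := by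
  unfold pathExponent
  congr 1
  refine Finset.sum_congr rfl fun t ht => ?_
  have := Finset.mem_range.1 ht
  rw [(h t (by omega)).1, (h t (by omega)).2, (h (t + 1) (by omega)).1]

/-! ### The matching on index sets -/

namespace HIndex

variable {n : ℕ}

/-- The summands of the two composites of homotopies indexed by `x` and `y` have the same
vertices. -/
def SameVertices (x y : HIndex n × HIndex (n + 1)) : Prop :=
  ∀ t ≤ n + 2, y.1.lv (y.2.lv t) = x.1.lv (x.2.lv t) ∧
    y.1.lv (y.2.rv t) = x.1.rv (x.2.lv t) ∧ y.1.rv (y.2.rv t) = x.1.rv (x.2.rv t)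

/-- The summand of the first composite indexed by `x` has no repeated vertices. -/
def NonDegenL (x : HIndex n × HIndex (n + 1)) : Prop :=
  NonDegen (n + 1) (x.1.lv ∘ x.2.lv) (x.1.rv ∘ x.2.lv) (x.1.rv ∘ x.2.rv)

/-- The summand of the second composite indexed by `x` has no repeated vertices. -/
def NonDegenR (x : HIndex n × HIndex (n + 1)) : Prop :=
  NonDegen (n + 1) (x.1.lv ∘ x.2.lv) (x.1.lv ∘ x.2.rv) (x.1.rv ∘ x.2.rv)

lemma NonDegenL.isLeftPair {x : HIndex n × HIndex (n + 1)} (h : NonDegenL x) :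
    IsLeftPair n x.1.a x.1.b x.2.a x.2.b x.1.lv x.1.rv x.2.lv x.2.rv :=
  isLeftPair_of_nonDegen x.1.isPath x.2.isPath h

lemma NonDegenR.isRightPair {x : HIndex n × HIndex (n + 1)} (h : NonDegenR x) :
    IsRightPair n x.1.a x.1.b x.2.a x.2.b x.1.lv x.1.rv x.2.lv x.2.rv :=
  isRightPair_of_nonDegen x.1.isPath x.2.isPath h

lemma SameVertices.nonDegen_iff {x y : HIndex n × HIndex (n + 1)} (h : SameVertices x y) :
    NonDegenL x ↔ NonDegenR y := by
  refine forall₂_congr fun t ht => ?_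
  simp only [Function.comp, h t (by omega), h (t + 1) (by omega)]

lemma SameVertices.left_unique {x x' y : HIndex n × HIndex (n + 1)} (hx : NonDegenL x)
    (hx' : NonDegenL x') (h : SameVertices x y) (h' : SameVertices x' y) : x = x' := by
  obtain ⟨h1, h2⟩ := hx.isLeftPair.unique hx'.isLeftPair fun t ht => by
    obtain ⟨e1, e2, e3⟩ := h t ht
    obtain ⟨e1', e2', e3'⟩ := h' t ht
    exact ⟨e1.symm.trans e1', e2.symm.trans e2', e3.symm.trans e3'⟩
  exact Prod.ext (ext_of_eq h1) (ext_of_eq h2)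

lemma SameVertices.right_unique {x y y' : HIndex n × HIndex (n + 1)} (hy : NonDegenR y)
    (hy' : NonDegenR y') (h : SameVertices x y) (h' : SameVertices x y') : y = y' := by
  obtain ⟨h1, h2⟩ := hy.isRightPair.unique hy'.isRightPair fun t ht => by
    obtain ⟨e1, e2, e3⟩ := h t ht
    obtain ⟨e1', e2', e3'⟩ := h' t ht
    exact ⟨e1.trans e1'.symm, e2.trans e2'.symm, e3.trans e3'.symm⟩
  exact Prod.ext (ext_of_eq h1) (ext_of_eq h2)

lemma NonDegenL.exists_sameVertices {x : HIndex n × HIndex (n + 1)} (hx : NonDegenL x) :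
    ∃ y, SameVertices x y ∧ y.1.sign * y.2.sign = -(x.1.sign * x.2.sign) := by
  obtain ⟨c, d, c', d', k, l, w, z, h⟩ := hx.isLeftPair.exists_matched
  obtain ⟨i, rfl, rfl, hi⟩ := h.right.fst.exists_index
  obtain ⟨j, rfl, rfl, hj⟩ := h.right.snd.exists_index
  refine ⟨(i, j), fun t ht => ?_, ?_⟩
  · have h1 := (h.right.snd.left_le t ht).trans h.right.snd.le
    have h2 := h.right.snd.right_le t ht
    rw [(hj t ht).1, (hj t ht).2, (hi _ h1).1, (hi _ h2).1, (hi _ h2).2]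
    exact ⟨h.fst t ht, h.snd t ht, h.trd t ht⟩
  · have := h.odd_exponent
    simp only [sign_eq, ← Units.val_mul, ← Int.negOnePow_add, ← Units.val_neg]
    rw [pathExponent_congr hi, pathExponent_congr hj]
    obtain ⟨r, hr⟩ := this
    rw [← Int.negOnePow_succ, Units.val_inj, Int.negOnePow_eq_iff]
    exact ⟨r, by linear_combination hr⟩

lemma NonDegenR.exists_sameVertices {y : HIndex n × HIndex (n + 1)} (hy : NonDegenR y) :
    ∃ x, SameVertices x y := by
  obtain ⟨a, b, a', b', f, g, u, v, h, h', e⟩ := hy.isRightPair.exists_left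
  obtain ⟨i, rfl, rfl, hi⟩ := h.exists_index
  obtain ⟨j, rfl, rfl, hj⟩ := h'.exists_index
  refine ⟨(i, j), fun t ht => ?_⟩
  have h1 := (h'.left_le t ht).trans h'.le
  have h2 := h'.right_le t ht
  rw [(hj t ht).1, (hj t ht).2, (hi _ h1).1, (hi _ h1).2, (hi _ h2).2]
  exact e t ht

end HIndex

/-- Two sums agree when their nonzero summands are in bijection, where the bijection is given by
a relation. -/
lemma sum_eq_sum_of_rel {ι κ M : Type*} [Fintype ι] [Fintype κ] [AddCommMonoid M]
    {P : ι → Prop} {Q : κ → Prop} {F : ι → M} {G : κ → M} (r : ι → κ → Prop)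
    (hF : ∀ i, ¬ P i → F i = 0) (hG : ∀ k, ¬ Q k → G k = 0)
    (iff : ∀ i k, r i k → (P i ↔ Q k))
    (left : ∀ i, P i → ∃ k, r i k ∧ F i = G k) (right : ∀ k, Q k → ∃ i, r i k)
    (left_unique : ∀ i i' k, P i → P i' → r i k → r i' k → i = i')
    (right_unique : ∀ i k k', Q k → Q k' → r i k → r i k' → k = k') :
    ∑ i, F i = ∑ k, G k := by
  classical
  rw [← Finset.sum_filter_of_ne (p := P) fun i _ h => by by_contra hi; exact h (hF i hi),
    ← Finset.sum_filter_of_ne (p := Q) fun k _ h => by by_contra hk; exact h (hG k hk)]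
  choose e he using left
  have hP : ∀ {i}, i ∈ Finset.univ.filter P → P i := fun h => (Finset.mem_filter.1 h).2
  have hQ : ∀ {k}, k ∈ Finset.univ.filter Q → Q k := fun h => (Finset.mem_filter.1 h).2
  refine Finset.sum_bij (fun i hi => e i (hP hi)) (fun i hi => ?_) (fun i hi i' hi' h => ?_)
    (fun k hk => ?_) (fun i hi => (he i (hP hi)).2)
  · exact Finset.mem_filter.2
      ⟨Finset.mem_univ _, (iff _ _ (he i (hP hi)).1).1 (hP hi)⟩
  · exact left_unique _ _ _ (hP hi) (hP hi') (he i (hP hi)).1 (h ▸ (he i' (hP hi')).1)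
  -- This `i` is related both to `k` and to its chosen partner, which therefore coincide.
  · obtain ⟨i, hi⟩ := right k (hQ hk)
    have hPi := (iff _ _ hi).2 (hQ hk)
    have hr := (he i hPi).1
    exact ⟨i, Finset.mem_filter.2 ⟨Finset.mem_univ _, hPi⟩,
      right_unique i _ _ ((iff _ _ hr).1 hPi) (hQ hk) hr hi⟩

/-! ### Composites of homotopies -/

section

variable (R : Type v) [CommRing R]

/-- The class of a simplex in the normalized chains. -/
noncomputable def simplexClass {X : SSet.{u}} {n : ℕ} (x : X _⦋n⦌) : NormalizedChains R X n :=
  (degenerateChains R X n).mkQ (Finsupp.single x 1)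

lemma simplexClass_eq_zero {X : SSet.{u}} {n : ℕ} {x : X _⦋n⦌} (h : x ∈ X.degenerate n) :
    simplexClass R x = 0 :=
  (Submodule.Quotient.mk_eq_zero _).2 (Submodule.subset_span ⟨x, h, rfl⟩)

lemma chainMap_simplexClass {X Y : SSet.{u}} (f : X ⟶ Y) {n : ℕ} (x : X _⦋n⦌) :
    chainMap R f n (simplexClass R x) = simplexClass R (f.app _ x) := by
  simp [chainMap, simplexClass]

lemma homotopy_simplexClass (X Y : SSet.{u}) {n : ℕ} (x : (X ⊗ Y) _⦋n⦌) :
    homotopy R X Y n (simplexClass R x) =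
      ∑ i : HIndex n, (i.sign : R) • simplexClass R (i.term X Y x) := by
  simp only [homotopy, simplexClass, Submodule.mkQ_apply, Submodule.mapQ_apply, homotopyPre,
    Finsupp.lift_apply, zero_smul, Finsupp.sum_single_index, one_smul]
  rw [← Submodule.mkQ_apply, map_sum]
  refine Finset.sum_congr rfl fun i _ => ?_
  rw [← Submodule.mkQ_apply, ← map_smul, Finsupp.smul_single, smul_eq_mul, mul_one]

variable {R} in
lemma linearMap_ext_simplexClass {X : SSet.{u}} {n : ℕ} {M : Type*} [AddCommGroup M] [Module R M]
    {f g : NormalizedChains R X n →ₗ[R] M}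
    (h : ∀ x : X _⦋n⦌, f (simplexClass R x) = g (simplexClass R x)) : f = g := by
  refine Submodule.linearMap_qext _ (Finsupp.lhom_ext' fun x => LinearMap.ext_ring ?_)
  exact h x

variable (X Y Z : SSet.{u}) {n : ℕ}

/-- The simplex `(φ^* x, ψ^* y, χ^* z)`. -/
def tripleMap {m : ℕ} (x : ((X ⊗ Y) ⊗ Z) _⦋n⦌) (φ ψ χ : ⦋m⦌ ⟶ ⦋n⦌) : ((X ⊗ Y) ⊗ Z) _⦋m⦌ :=
  ((X.map φ.op x.1.1, Y.map ψ.op x.1.2), Z.map χ.op x.2)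

lemma tripleMap_mem_degenerate {m : ℕ} (x : ((X ⊗ Y) ⊗ Z) _⦋n⦌) (φ ψ χ : ⦋m + 1⦌ ⟶ ⦋n⦌)
    (t : Fin (m + 1)) (h1 : φ.toOrderHom t.castSucc = φ.toOrderHom t.succ)
    (h2 : ψ.toOrderHom t.castSucc = ψ.toOrderHom t.succ)
    (h3 : χ.toOrderHom t.castSucc = χ.toOrderHom t.succ) :
    tripleMap X Y Z x φ ψ χ ∈ ((X ⊗ Y) ⊗ Z).degenerate (m + 1) := by
  obtain ⟨φ', rfl⟩ := SimplexCategory.eq_σ_comp_of_not_injective' _ _ h1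
  obtain ⟨ψ', rfl⟩ := SimplexCategory.eq_σ_comp_of_not_injective' _ _ h2
  obtain ⟨χ', rfl⟩ := SimplexCategory.eq_σ_comp_of_not_injective' _ _ h3
  refine ⟨m, by omega, SimplexCategory.σ t, tripleMap X Y Z x φ' ψ' χ', ?_⟩
  refine Prod.ext (Prod.ext ?_ ?_) ?_
  · exact (X.map_comp_apply φ'.op (SimplexCategory.σ t).op x.1.1).symm
  · exact (Y.map_comp_apply ψ'.op (SimplexCategory.σ t).op x.1.2).symm
  · exact (Z.map_comp_apply χ'.op (SimplexCategory.σ t).op x.2).symm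

lemma homotopyXYZ₁_simplexClass (x : ((X ⊗ Y) ⊗ Z) _⦋n⦌) :
    homotopyXYZ₁ R X Y Z n (simplexClass R x) = ∑ i : HIndex n,
      (i.sign : R) • simplexClass R (tripleMap X Y Z x i.leftHom i.leftHom i.rightHom) := by
  rw [homotopyXYZ₁, homotopy_simplexClass]
  refine Finset.sum_congr rfl fun i _ => ?_
  congr 2
  exact Prod.ext (i.left_eq _ _) (i.right_eq _ _)

lemma homotopyXYZ₂_simplexClass (x : ((X ⊗ Y) ⊗ Z) _⦋n⦌) :
    homotopyXYZ₂ R X Y Z n (simplexClass R x) = ∑ i : HIndex n,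
      (i.sign : R) • simplexClass R (tripleMap X Y Z x i.leftHom i.rightHom i.rightHom) := by
  rw [homotopyXYZ₂, LinearMap.comp_apply, LinearMap.comp_apply, chainMap_simplexClass,
    homotopy_simplexClass, map_sum]
  refine Finset.sum_congr rfl fun i _ => ?_
  rw [map_smul, chainMap_simplexClass]
  congr 2
  have : i.term X (Y ⊗ Z) ((α_ X Y Z).hom.app _ x) =
      (X.map i.leftHom.op x.1.1, (Y.map i.rightHom.op x.1.2, Z.map i.rightHom.op x.2)) :=
    Prod.ext (i.left_eq _ _) (i.right_eq _ _)
  rw [this]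
  rfl

lemma tripleMap_tripleMap {k m : ℕ} (x : ((X ⊗ Y) ⊗ Z) _⦋n⦌) (φ ψ χ : ⦋m⦌ ⟶ ⦋n⦌)
    (φ' ψ' χ' : ⦋k⦌ ⟶ ⦋m⦌) :
    tripleMap X Y Z (tripleMap X Y Z x φ ψ χ) φ' ψ' χ' =
      tripleMap X Y Z x (φ' ≫ φ) (ψ' ≫ ψ) (χ' ≫ χ) := by
  simp [tripleMap]

lemma comp_simplexClass₁₂ (x : ((X ⊗ Y) ⊗ Z) _⦋n⦌) :
    homotopyXYZ₁ R X Y Z (n + 1) (homotopyXYZ₂ R X Y Z n (simplexClass R x)) =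
      ∑ i : HIndex n × HIndex (n + 1), ((i.1.sign * i.2.sign : ℤ) : R) • simplexClass R
        (tripleMap X Y Z x (i.2.leftHom ≫ i.1.leftHom) (i.2.leftHom ≫ i.1.rightHom)
          (i.2.rightHom ≫ i.1.rightHom)) := by
  simp only [homotopyXYZ₂_simplexClass, map_sum, map_smul, homotopyXYZ₁_simplexClass,
    Finset.smul_sum, smul_smul, tripleMap_tripleMap, Fintype.sum_prod_type, Int.cast_mul]

lemma comp_simplexClass₂₁ (x : ((X ⊗ Y) ⊗ Z) _⦋n⦌) :
    homotopyXYZ₂ R X Y Z (n + 1) (homotopyXYZ₁ R X Y Z n (simplexClass R x)) =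
      ∑ i : HIndex n × HIndex (n + 1), ((i.1.sign * i.2.sign : ℤ) : R) • simplexClass R
        (tripleMap X Y Z x (i.2.leftHom ≫ i.1.leftHom) (i.2.rightHom ≫ i.1.leftHom)
          (i.2.rightHom ≫ i.1.rightHom)) := by
  simp only [homotopyXYZ₂_simplexClass, map_sum, map_smul, homotopyXYZ₁_simplexClass,
    Finset.smul_sum, smul_smul, tripleMap_tripleMap, Fintype.sum_prod_type, Int.cast_mul]

/-- The criterion involves the vertex maps alone. Other summands may still be degenerate for a
particular `x`, which is harmless since they are matched by index. -/
lemma simplexClass_eq_zero_of_not_nonDegen {m : ℕ} (x : ((X ⊗ Y) ⊗ Z) _⦋n⦌)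
    (φ ψ χ : ⦋m + 1⦌ ⟶ ⦋n⦌) {φ' ψ' χ' : ℕ → ℕ} (h : ¬ NonDegen m φ' ψ' χ')
    (h1 : ∀ t, (φ.toOrderHom t).val = φ' t.val) (h2 : ∀ t, (ψ.toOrderHom t).val = ψ' t.val)
    (h3 : ∀ t, (χ.toOrderHom t).val = χ' t.val) :
    simplexClass R (tripleMap X Y Z x φ ψ χ) = 0 := by
  simp only [NonDegen, not_forall, not_not] at h
  obtain ⟨t, ht, e1, e2, e3⟩ := h
  refine simplexClass_eq_zero R (tripleMap_mem_degenerate X Y Z x φ ψ χ ⟨t, by omega⟩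
    (Fin.ext ?_) (Fin.ext ?_) (Fin.ext ?_))
  · rw [h1, h1]; exact e1
  · rw [h2, h2]; exact e2
  · rw [h3, h3]; exact e3

lemma hom_ext_val {k m : ℕ} {φ ψ : ⦋k⦌ ⟶ ⦋m⦌}
    (h : ∀ t, (φ.toOrderHom t).val = (ψ.toOrderHom t).val) : φ = ψ :=
  SimplexCategory.Hom.ext _ _ (OrderHom.ext _ _ (funext fun t => Fin.ext (h t)))

end

end EilenbergZilber

theorem mainTheorem2 (R : Type v) [CommRing R] (X Y Z : SSet.{u}) (n : ℕ) :
    EilenbergZilber.homotopyXYZ₁ R X Y Z (n + 1) ∘ₗ EilenbergZilber.homotopyXYZ₂ R X Y Z n =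
      -(EilenbergZilber.homotopyXYZ₂ R X Y Z (n + 1) ∘ₗ
          EilenbergZilber.homotopyXYZ₁ R X Y Z n) := by
  open EilenbergZilber HIndex in
  refine linearMap_ext_simplexClass fun x => ?_
  rw [LinearMap.neg_apply, LinearMap.comp_apply, LinearMap.comp_apply, comp_simplexClass₁₂,
    comp_simplexClass₂₁, ← Finset.sum_neg_distrib]
  refine sum_eq_sum_of_rel (P := NonDegenL) (Q := NonDegenR) SameVertices (fun i hi => ?_)
    (fun i hi => ?_) (fun _ _ h => h.nonDegen_iff) (fun i hi => ?_)
    (fun _ h => h.exists_sameVertices) (fun _ _ _ hi hi' h h' => h.left_unique hi hi' h')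
    (fun _ _ _ hk hk' h h' => h.right_unique hk hk' h')
  · rw [simplexClass_eq_zero_of_not_nonDegen R X Y Z x _ _ _ hi (fun _ => rfl) (fun _ => rfl)
      (fun _ => rfl), smul_zero]
  · rw [simplexClass_eq_zero_of_not_nonDegen R X Y Z x _ _ _ hi (fun _ => rfl) (fun _ => rfl)
      (fun _ => rfl), smul_zero, neg_zero]
  · obtain ⟨k, hk, hs⟩ := hi.exists_sameVertices
    refine ⟨k, hk, ?_⟩
    rw [hs, Int.cast_neg, neg_smul, neg_neg]
    congr 3
    · exact hom_ext_val fun t => (hk t (Nat.lt_succ_iff.1 t.2)).1.symm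
    · exact hom_ext_val fun t => (hk t (Nat.lt_succ_iff.1 t.2)).2.1.symm
    · exact hom_ext_val fun t => (hk t (Nat.lt_succ_iff.1 t.2)).2.2.symm
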